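/- Let $t\ge 4$. The following two parameterized problems are $\mathrm{W}[2]$-hard under parameterized (fpt-)reductions; in particular, this holds for $4$-claw-free graphs ($t=4$). In both problems the input consists of a $t$-claw-free graph $G$, that is, a finite simple undirected graph that does not contain $K_{1,t}$ as an induced subgraph, and an integer $k\ge 0$, and the parameter is $k$. * *Connected Dominating Set:* does $G$ have a dominating set $D$ with $|D|\le k$ such that the induced subgraph $G[D]$ is connected? * *Dominating Clique:* does $G$ have a dominating set $D$ with $|D|\le k$ such that $G[D]$ is a clique? Here $D\subseteq V(G)$ is a dominating set if every vertex outside $D$ has a neighbour in $D$. A parameterized reduction from $P$ to $Q$ is an algorithm that maps every instance $(x,k)$ of $P$, in time $f(k)\cdot(|x|+1)^{c}$, to an equivalent instance $(y,\ell)$ of $Q$ with $\ell\le g(k)$, where $f,g$ are computable functions and $c$ is a constant; so the instances of the two problems above that a reduction produces are always $t$-claw-free graphs. $\mathrm{W}[2]$ is the class of parameterized problems that are fpt-reducible, for some first-order $\Pi_2$-formula $\varphi(X)=\forall \bar x\,\exists\bar y\,\psi(\bar x,\bar y,X)$ ($\psi$ quantifier-free) with a free relation variable $X$ over a finite relational vocabulary,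 to the problem: given a finite structure $A$ and $k$ (the parameter), is there a relation $S$ on $A$, of the arity of $X$, with exactly $k$ tuples and $A\models\varphi(S)$? A problem $Q$ is $\mathrm{W}[2]$-hard if every problem in $\mathrm{W}[2]$ is fpt-reducible to $Q$. -/

import Mathlib

/-!
Graph problems, a random access machine with a step count, parameterized reductions over that
machine, and the class W[2].
-/

namespace ParamComplexity

/-! ### Random access machine -/

/-- Memory of the machine: scalar registers `reg 0, reg 1, …` and arrays `arr 0, arr 1, …`, all
holding natural numbers. A program mentions only finitely many registers and arrays. -/
structure Mem where
  reg : ℕ → ℕ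
  arr : ℕ → ℕ → ℕ

/-- Programs. The only arithmetic operations are addition and (truncated) subtraction, so numbers
grow by at most one bit per step and unit cost is polynomially equivalent to Turing machine time. -/
inductive Prog : Type
  /-- `reg i := c` -/
  | const (i c : ℕ)
  /-- `reg i := reg j + reg l` -/
  | add (i j l : ℕ)
  /-- `reg i := max (reg j - reg l) 0` -/
  | sub (i j l : ℕ)
  /-- `reg i := arr a [reg j]` -/
  | load (i a j : ℕ)
  /-- `arr a [reg i] := reg j` -/
  | store (a i j : ℕ)
  /-- sequential composition -/
  | seq (p q : Prog)
  /-- `if reg i ≠ 0 then p else q` -/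
  | ite (i : ℕ) (p q : Prog)
  /-- `while reg i ≠ 0 do p` -/
  | while (i : ℕ) (p : Prog)

/-- `m.setReg i v` is `m` after `reg i := v`. -/
def Mem.setReg (m : Mem) (i v : ℕ) : Mem :=
  { m with reg := Function.update m.reg i v }

/-- `m.setArr a i v` is `m` after `arr a [i] := v`. -/
def Mem.setArr (m : Mem) (a i v : ℕ) : Mem :=
  { m with arr := Function.update m.arr a (Function.update (m.arr a) i v) }

/-- `Runs p m m' T`: started in memory `m`, the program `p` halts with memory `m'` after exactly
`T` steps. Each elementary instruction and each test costs one step. -/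
inductive Runs : Prog → Mem → Mem → ℕ → Prop
  | const (m : Mem) (i c : ℕ) : Runs (.const i c) m (m.setReg i c) 1
  | add (m : Mem) (i j l : ℕ) : Runs (.add i j l) m (m.setReg i (m.reg j + m.reg l)) 1
  | sub (m : Mem) (i j l : ℕ) : Runs (.sub i j l) m (m.setReg i (m.reg j - m.reg l)) 1
  | load (m : Mem) (i a j : ℕ) : Runs (.load i a j) m (m.setReg i (m.arr a (m.reg j))) 1
  | store (m : Mem) (a i j : ℕ) : Runs (.store a i j) m (m.setArr a (m.reg i) (m.reg j)) 1
  | seq {p q : Prog} {m m₁ m₂ : Mem} {T₁ T₂ : ℕ} (hp : Runs p m m₁ T₁) (hq : Runs q m₁ m₂ T₂) :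
      Runs (.seq p q) m m₂ (T₁ + T₂)
  | ite_true {i : ℕ} {p q : Prog} {m m' : Mem} {T : ℕ} (hi : m.reg i ≠ 0) (hp : Runs p m m' T) :
      Runs (.ite i p q) m m' (T + 1)
  | ite_false {i : ℕ} {p q : Prog} {m m' : Mem} {T : ℕ} (hi : m.reg i = 0) (hq : Runs q m m' T) :
      Runs (.ite i p q) m m' (T + 1)
  | while_done {i : ℕ} {p : Prog} {m : Mem} (hi : m.reg i = 0) : Runs (.while i p) m m 1
  | while_step {i : ℕ} {p : Prog} {m m₁ m₂ : Mem} {T₁ T₂ : ℕ} (hi : m.reg i ≠ 0)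
      (hp : Runs p m m₁ T₁) (hw : Runs (.while i p) m₁ m₂ T₂) :
      Runs (.while i p) m m₂ (T₁ + T₂ + 1)

/-- A bit string as the contents of an array: `1` for the bit `false`, `2` for the bit `true`, and
`0` in all cells after the end of the string. (So every bit of an output has been written.) -/
def cells (x : List Bool) (i : ℕ) : ℕ :=
  match x[i]? with
  | none => 0
  | some false => 1
  | some true => 2

/-- Initial memory on input `(x, k)`: the string `x` in array `0`, the parameter `k` in register
`0`, and `0` everywhere else. -/
def inputMem (x : List Bool) (k : ℕ) : Mem where
  reg := Function.update (fun _ => 0) 0 k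
  arr := Function.update (fun _ _ => 0) 0 (cells x)

/-- The memory `m` presents the output `(x, k)`. -/
def IsOutput (m : Mem) (x : List Bool) (k : ℕ) : Prop :=
  m.arr 0 = cells x ∧ m.reg 0 = k

/-- On input `(x, k)` the program `p` halts within `T` steps with output `(y, l)`. -/
def ComputesWithin (p : Prog) (x : List Bool) (k : ℕ) (y : List Bool) (l T : ℕ) : Prop :=
  ∃ m T', Runs p (inputMem x k) m T' ∧ IsOutput m y l ∧ T' ≤ T

/-! ### Parameterized problems and reductions -/

/-- A parameterized decision problem: a set of instances `(x, k)`, consisting of a bit string `x`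
and the parameter `k`, and the set of the yes-instances. A parameterized language over `{0,1}` is
the case `inst = univ`; smaller sets `inst` express the restriction of a problem to a class of
inputs. -/
structure ParamProblem where
  inst : Set (List Bool × ℕ)
  yes : Set (List Bool × ℕ)
  yes_subset : yes ⊆ inst

/-- `P` is reducible to `Q` by a parameterized (fpt-)reduction: there are computable functions
`f`, `g`, a constant `c` and a program that maps each instance `(x, k)` of `P`, in at most
`f(k) * (|x| + 1) ^ c` steps, to an equivalent instance `(y, l)` of `Q` with `l ≤ g(k)`. -/
def FPTReducible (P Q : ParamProblem) : Prop :=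
  ∃ (p : Prog) (f g : ℕ → ℕ) (c : ℕ), Computable f ∧ Computable g ∧
    ∀ x k, (x, k) ∈ P.inst →
      ∃ y l, ComputesWithin p x k y l (f k * (x.length + 1) ^ c) ∧
        (y, l) ∈ Q.inst ∧ ((x, k) ∈ P.yes ↔ (y, l) ∈ Q.yes) ∧ l ≤ g k

/-! ### Weighted definability and the class W[2] -/

/-- A finite structure with nonempty universe `{0, …, size - 1}` over the vocabulary with relation
symbols `0, …, m - 1`, the symbol `r` having arity `ar r`. -/
structure FinStruct {m : ℕ} (ar : Fin m → ℕ) where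
  size : ℕ
  size_pos : 0 < size
  rel : (r : Fin m) → (Fin (ar r) → Fin size) → Bool

/-- The structure as a bit string: the size of the universe in unary, a separator, and then the
truth table of each relation, the tuples `(a₀, a₁, …)` being ordered by `∑ aᵢ * size ^ i`. -/
def FinStruct.encode {m : ℕ} {ar : Fin m → ℕ} (A : FinStruct ar) : List Bool :=
  List.replicate A.size true ++ false ::
    (List.finRange m).flatMap fun r =>
      List.ofFn fun j : Fin (A.size ^ ar r) => A.rel r (finFunctionFinEquiv.symm j)

/-- Quantifier-free first-order formulas with first-order variables in `V`, over the vocabulary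
`ar` and one additional relation variable `X` of arity `s`. -/
inductive QFFormula {m : ℕ} (ar : Fin m → ℕ) (s : ℕ) (V : Type) : Type
  | eq (u v : V)
  | rel (r : Fin m) (args : Fin (ar r) → V)
  | X (args : Fin s → V)
  | not (φ : QFFormula ar s V)
  | and (φ ψ : QFFormula ar s V)
  | or (φ ψ : QFFormula ar s V)

/-- Truth of a quantifier-free formula in `A`, with `X` interpreted by `S` and the first-order
variables by `val`. -/
def QFFormula.Holds {m : ℕ} {ar : Fin m → ℕ} {s : ℕ} {V : Type} (A : FinStruct ar)
    (S : Finset (Fin s → Fin A.size)) (val : V → Fin A.size) : QFFormula ar s V → Prop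
  | .eq u v => val u = val v
  | .rel r args => A.rel r (fun i => val (args i)) = true
  | .X args => (fun i => val (args i)) ∈ S
  | .not φ => ¬ φ.Holds A S val
  | .and φ ψ => φ.Holds A S val ∧ ψ.Holds A S val
  | .or φ ψ => φ.Holds A S val ∨ ψ.Holds A S val

/-- A `Π₂`-formula `φ(X) = ∀ x₁ … x_p ∃ y₁ … y_q ψ` with `ψ` quantifier-free, over a finite
relational vocabulary, with one free relation variable `X` of arity `s`. -/
structure Pi2Formula where
  m : ℕ
  ar : Fin m → ℕ
  s : ℕ
  p : ℕ
  q : ℕ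
  matrix : QFFormula ar s (Fin p ⊕ Fin q)

/-- `A ⊨ φ(S)`. -/
def Pi2Formula.Holds (φ : Pi2Formula) (A : FinStruct φ.ar)
    (S : Finset (Fin φ.s → Fin A.size)) : Prop :=
  ∀ a : Fin φ.p → Fin A.size, ∃ b : Fin φ.q → Fin A.size, φ.matrix.Holds A S (Sum.elim a b)

/-- The weighted definability problem of `φ(X)`: given a finite structure `A` and `k : ℕ`, with
parameter `k`, is there a set `S` of exactly `k` tuples such that `A ⊨ φ(S)`? -/
def weightedDefinability (φ : Pi2Formula) : ParamProblem where
  inst := {z | ∃ A : FinStruct φ.ar, z.1 = A.encode}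
  yes := {z | ∃ A : FinStruct φ.ar, z.1 = A.encode ∧
    ∃ S : Finset (Fin φ.s → Fin A.size), S.card = z.2 ∧ φ.Holds A S}
  yes_subset := fun _ ⟨A, hA, _⟩ => ⟨A, hA⟩

/-- The class W[2]: the closure under fpt-reductions of the weighted definability problems of
`Π₂`-formulas. -/
def W2 : Set ParamProblem :=
  {P | ∃ φ : Pi2Formula, FPTReducible P (weightedDefinability φ)}

/-- W[2]-hardness under fpt-reductions. -/
def W2Hard (Q : ParamProblem) : Prop :=
  ∀ P ∈ W2, FPTReducible P Q

/-! ### Graph problems -/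

open Classical in
/-- A graph as a bit string: the number of vertices in unary, a separator, and the rows of the
adjacency matrix. -/
noncomputable def encodeGraph {n : ℕ} (G : SimpleGraph (Fin n)) : List Bool :=
  List.replicate n true ++ false ::
    (List.finRange n).flatMap fun i => (List.finRange n).map fun j => decide (G.Adj i j)

/-- The graph excludes the `t`-claw `K_{1,t}` as an induced subgraph. -/
def ClawFree (t : ℕ) {V : Type} (G : SimpleGraph V) : Prop :=
  ¬ (completeBipartiteGraph (Fin 1) (Fin t)).IsIndContained G

/-- Every vertex outside `D` has a neighbour in `D`. -/
def IsDominatingSet {V : Type} (G : SimpleGraph V) (D : Set V) : Prop :=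
  ∀ v, v ∉ D → ∃ u ∈ D, G.Adj u v

/-- Connected Dominating Set, parameterized by solution size, on `t`-claw-free graphs: given such a
graph `G` and `k`, is there a dominating set of size at most `k` that induces a connected
subgraph? -/
def connectedDominatingSet (t : ℕ) : ParamProblem where
  inst := {z | ∃ (n : ℕ) (G : SimpleGraph (Fin n)), ClawFree t G ∧ z.1 = encodeGraph G}
  yes := {z | ∃ (n : ℕ) (G : SimpleGraph (Fin n)), (ClawFree t G ∧ z.1 = encodeGraph G) ∧
    ∃ D : Finset (Fin n), D.card ≤ z.2 ∧ IsDominatingSet G D ∧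
      (G.induce (D : Set (Fin n))).Connected}
  yes_subset := fun _ ⟨n, G, h, _⟩ => ⟨n, G, h⟩

/-- Dominating Clique, parameterized by solution size, on `t`-claw-free graphs: given such a graph
`G` and `k`, is there a dominating set of size at most `k` that is a clique? -/
def dominatingClique (t : ℕ) : ParamProblem where
  inst := {z | ∃ (n : ℕ) (G : SimpleGraph (Fin n)), ClawFree t G ∧ z.1 = encodeGraph G}
  yes := {z | ∃ (n : ℕ) (G : SimpleGraph (Fin n)), (ClawFree t G ∧ z.1 = encodeGraph G) ∧
    ∃ D : Finset (Fin n), D.card ≤ z.2 ∧ IsDominatingSet G D ∧ G.IsClique (D : Set (Fin n))}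
  yes_subset := fun _ ⟨n, G, h, _⟩ => ⟨n, G, h⟩

end ParamComplexity

/-! Since fpt-reductions compose, it suffices to reduce weighted definability of each fixed formula
`φ = ∀∃ψ` to both problems (`w2Hard_of_graph`); one graph serves for both.

Represent a set `S` of `k` tuples by the increasing enumeration `σ` of its tuple codes (each plus
one), with sentinels `σ 0 = 0` and `σ (k + 1) = n ^ s + 1`. For one assignment, the truth value of
`ψ` is certified by boundedly many values of `σ`: an occurrence of `X` is settled by one value equal
to the code, or by two consecutive values with the code strictly between them
(`QFFormula.Cert.sound`, `QFFormula.Cert.complete`). With `w = φ.width`, make a class for each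
`w`-tuple of indices, whose elements are the `w`-tuples of values. There are `K = (k + 2) ^ w`
classes, a number depending on `k` only. A solution `S` exists iff one element can be selected from
each class such that any two selected elements are consistent and each assignment of the universal
variables is certified by some selected element (`weightedDefinability_yes_iff`). The existential
variables are searched by brute force, as their number is fixed.

These conditions say that the selection hits certain sets. Certification is already of this form.
For consistency, a set for each element `u` of a class `J` and each class `J'` contains all other
elements of `J` and all elements of `J'` consistent with `u`.

In the graph, elements form a clique, sets form a clique, and each class has private vertices
adjacent only to each other and to the elements of the class. No vertex has four pairwise
nonadjacent neighbours (`gadget_clawFree`). A dominating set of at most `K` vertices must spend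
exactly one vertex on each class to dominate the private vertices, so the sets have to be dominated
by elements, that is, hit. Conversely a selection is a nonempty dominating clique, hence also
connected.

For the running time, `PolyComp` is a class of machine-computable functions closed under arithmetic,
table lookup and bounded sums; adjacency in the graph belongs to it. -/

namespace ParamComplexity

/-! ### Running programs within a time bound -/

/-- Started in `m`, the program `p` halts within `τ` steps in a memory satisfying `Q`. -/
def RunsTo (p : Prog) (m : Mem) (τ : ℕ) (Q : Mem → Prop) : Prop :=
  ∃ m' T, Runs p m m' T ∧ T ≤ τ ∧ Q m'

namespace RunsTo

variable {p q : Prog} {m : Mem} {τ τ' : ℕ} {Q Q' : Mem → Prop}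

theorem mono (h : RunsTo p m τ Q) (hτ : τ ≤ τ') (hQ : ∀ m', Q m' → Q' m') : RunsTo p m τ' Q' := by
  obtain ⟨m', T, h₁, h₂, h₃⟩ := h
  exact ⟨m', T, h₁, h₂.trans hτ, hQ _ h₃⟩

theorem seq (h : RunsTo p m τ Q) (h' : ∀ m', Q m' → RunsTo q m' τ' Q') :
    RunsTo (.seq p q) m (τ + τ') Q' := by
  obtain ⟨m', T, h₁, h₂, h₃⟩ := h
  obtain ⟨m'', T', h₁', h₂', h₃'⟩ := h' m' h₃
  exact ⟨m'', T + T', .seq h₁ h₁', Nat.add_le_add h₂ h₂', h₃'⟩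

theorem const {i c : ℕ} (h : Q (m.setReg i c)) : RunsTo (.const i c) m 1 Q :=
  ⟨_, _, .const m i c, le_rfl, h⟩

theorem add {i j l : ℕ} (h : Q (m.setReg i (m.reg j + m.reg l))) : RunsTo (.add i j l) m 1 Q :=
  ⟨_, _, .add m i j l, le_rfl, h⟩

theorem sub {i j l : ℕ} (h : Q (m.setReg i (m.reg j - m.reg l))) : RunsTo (.sub i j l) m 1 Q :=
  ⟨_, _, .sub m i j l, le_rfl, h⟩

theorem load {i a j : ℕ} (h : Q (m.setReg i (m.arr a (m.reg j)))) : RunsTo (.load i a j) m 1 Q :=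
  ⟨_, _, .load m i a j, le_rfl, h⟩

theorem store {a i j : ℕ} (h : Q (m.setArr a (m.reg i) (m.reg j))) :
    RunsTo (.store a i j) m 1 Q :=
  ⟨_, _, .store m a i j, le_rfl, h⟩

/-- Pinning the intermediate memory exactly, this rule and its analogues below execute a program
symbolically, without stating intermediate assertions. -/
theorem const_seq {i c : ℕ} (h : RunsTo p (m.setReg i c) τ Q) :
    RunsTo (.seq (.const i c) p) m (1 + τ) Q :=
  seq (Q := fun m' => m' = m.setReg i c) (const rfl) (by rintro _ rfl; exact h)

theorem add_seq {i j l : ℕ} (h : RunsTo p (m.setReg i (m.reg j + m.reg l)) τ Q) :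
    RunsTo (.seq (.add i j l) p) m (1 + τ) Q :=
  seq (Q := fun m' => m' = m.setReg i (m.reg j + m.reg l)) (add rfl) (by rintro _ rfl; exact h)

theorem sub_seq {i j l : ℕ} (h : RunsTo p (m.setReg i (m.reg j - m.reg l)) τ Q) :
    RunsTo (.seq (.sub i j l) p) m (1 + τ) Q :=
  seq (Q := fun m' => m' = m.setReg i (m.reg j - m.reg l)) (sub rfl) (by rintro _ rfl; exact h)

theorem load_seq {i a j : ℕ} (h : RunsTo p (m.setReg i (m.arr a (m.reg j))) τ Q) :
    RunsTo (.seq (.load i a j) p) m (1 + τ) Q :=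
  seq (Q := fun m' => m' = m.setReg i (m.arr a (m.reg j))) (load rfl) (by rintro _ rfl; exact h)

theorem ite {i : ℕ} (h₁ : m.reg i ≠ 0 → RunsTo p m τ Q) (h₂ : m.reg i = 0 → RunsTo q m τ Q) :
    RunsTo (.ite i p q) m (τ + 1) Q := by
  by_cases h : m.reg i = 0
  · obtain ⟨m', T, a, b, c⟩ := h₂ h
    exact ⟨m', T + 1, .ite_false h a, by omega, c⟩
  · obtain ⟨m', T, a, b, c⟩ := h₁ h
    exact ⟨m', T + 1, .ite_true h a, by omega, c⟩

end RunsTo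

@[simp] theorem Mem.setReg_reg (m : Mem) (i v r : ℕ) :
    (m.setReg i v).reg r = if r = i then v else m.reg r := by
  simp [Mem.setReg, Function.update_apply]

@[simp] theorem Mem.setReg_arr (m : Mem) (i v : ℕ) : (m.setReg i v).arr = m.arr := rfl

@[simp] theorem Mem.setArr_reg (m : Mem) (a i v : ℕ) : (m.setArr a i v).reg = m.reg := rfl

@[simp] theorem Mem.setArr_arr (m : Mem) (a i v b : ℕ) :
    (m.setArr a i v).arr b = if b = a then Function.update (m.arr a) i v else m.arr b := by
  simp [Mem.setArr, Function.update_apply]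

/-- Run `p` as often as register `r` says, register `one` holding `1`. -/
def Prog.times (r one : ℕ) (p : Prog) : Prog := .while r (.seq p (.sub r r one))

/-- Invariant rule for `Prog.times`. -/
theorem RunsTo.times {r one : ℕ} (hr : r ≠ one) {p : Prog} {τ N : ℕ} (I : ℕ → Mem → Prop)
    (hI : ∀ i m v, I i m → I i (m.setReg r v))
    (hp : ∀ i m, i < N → I i m → m.reg one = 1 →
      RunsTo p m τ fun m' => I (i + 1) m' ∧ m'.reg one = 1 ∧ m'.reg r = m.reg r)
    {m : Mem} (h₀ : I 0 m) (h₁ : m.reg one = 1) (hN : m.reg r = N) :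
    RunsTo (p.times r one) m (N * (τ + 2) + 1) fun m' => I N m' ∧ m'.reg r = 0 := by
  -- The induction is on the number `j` of remaining rounds, while the invariant is indexed by the
  -- number `i` of completed ones.
  suffices H : ∀ j i m, i + j = N → I i m → m.reg one = 1 → m.reg r = j →
      RunsTo (p.times r one) m (j * (τ + 2) + 1) fun m' => I N m' ∧ m'.reg r = 0 from
    H N 0 m (by omega) h₀ h₁ hN
  intro j
  induction j with
  | zero =>
    intro i m hi hI' h1 hj
    obtain rfl : i = N := by omega
    exact ⟨m, 1, .while_done hj, by omega, hI', hj⟩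
  | succ j ih =>
    intro i m hi hI' h1 hj
    obtain ⟨m₁, T₁, a, b, c₁, c₂, c₃⟩ := hp i m (by omega) hI' h1
    obtain ⟨m₂, T₂, a', b', c'⟩ := ih (i + 1) (m₁.setReg r j) (by omega) (hI _ _ _ c₁)
      (by simp [hr.symm, c₂]) (by simp)
    refine ⟨m₂, (T₁ + 1) + T₂ + 1, .while_step (m₁ := m₁.setReg r j) (by omega) (.seq a ?_) a',
      ?_, c'⟩
    · have := Runs.sub m₁ r r one
      rwa [c₂, c₃, hj, Nat.add_sub_cancel] at this
    · have : (j + 1) * (τ + 2) = j * (τ + 2) + (τ + 2) := by ring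
      omega

/-! ### Polynomially bounded functions -/

/-- The function is bounded by a polynomial. -/
def PolyBounded (h : ℕ → ℕ) : Prop := ∃ c, ∀ V, h V ≤ (V + 2) ^ c

namespace PolyBounded

variable {g h : ℕ → ℕ}

/-- The base `V + 2` is at least `2`, so constants and constant factors are absorbed by a larger
exponent. -/
theorem const (a : ℕ) : PolyBounded fun _ => a :=
  ⟨a, fun V => Nat.lt_two_pow_self.le.trans (Nat.pow_le_pow_left (by omega) _)⟩

theorem id : PolyBounded fun V => V := ⟨1, fun V => by simp⟩

theorem mul (hg : PolyBounded g) (hh : PolyBounded h) : PolyBounded fun V => g V * h V := by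
  obtain ⟨a, ha⟩ := hg
  obtain ⟨b, hb⟩ := hh
  exact ⟨a + b, fun V => by rw [pow_add]; exact Nat.mul_le_mul (ha V) (hb V)⟩

theorem add (hg : PolyBounded g) (hh : PolyBounded h) : PolyBounded fun V => g V + h V := by
  obtain ⟨a, ha⟩ := hg
  obtain ⟨b, hb⟩ := hh
  refine ⟨a + b + 1, fun V => ?_⟩
  have h1 : (V + 2) ^ a ≤ (V + 2) ^ (a + b) := Nat.pow_le_pow_right (by omega) (by omega)
  have h2 : (V + 2) ^ b ≤ (V + 2) ^ (a + b) := Nat.pow_le_pow_right (by omega) (by omega)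
  calc g V + h V ≤ (V + 2) ^ (a + b) * 2 := by have := ha V; have := hb V; omega
    _ ≤ (V + 2) ^ (a + b) * (V + 2) := Nat.mul_le_mul_left _ (by omega)
    _ = _ := (pow_succ _ _).symm

theorem comp (hg : PolyBounded g) (hh : PolyBounded h) : PolyBounded fun V => g (h V) := by
  obtain ⟨a, ha⟩ := hg
  obtain ⟨b, hb⟩ := hh.add (const 2)
  exact ⟨b * a, fun V => (ha _).trans (by rw [pow_mul]; exact Nat.pow_le_pow_left (hb V) _)⟩

end PolyBounded

/-! ### Functions of the memory computable in polynomial time -/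

/-- The registers `0, …, 3` and the cells of array `0` hold values at most `V`. -/
def Mem.Le (m : Mem) (V : ℕ) : Prop := (∀ i < 4, m.reg i ≤ V) ∧ ∀ i, m.arr 0 i ≤ V

/-- `f` depends only on the registers `0, …, 3` and array `0`, and it is computed in polynomial
time by programs that leave the result in an arbitrary register `d ≥ 4` and preserve all smaller
registers and the arrays. -/
def PolyComp (f : Mem → ℕ) : Prop :=
  (∀ m m' : Mem, (∀ i < 4, m.reg i = m'.reg i) → m.arr 0 = m'.arr 0 → f m = f m') ∧
  ∃ h, PolyBounded h ∧ (∀ m V, m.Le V → f m ≤ h V) ∧ ∀ d, 4 ≤ d → ∃ p, ∀ m V, m.Le V →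
    RunsTo p m (h V) fun m' => (∀ r < d, m'.reg r = m.reg r) ∧ m'.arr = m.arr ∧ m'.reg d = f m

theorem Mem.Le.congr {m m' : Mem} {V : ℕ} (h : m.Le V) (hr : ∀ i < 4, m'.reg i = m.reg i)
    (ha : m'.arr 0 = m.arr 0) : m'.Le V :=
  ⟨fun i hi => hr i hi ▸ h.1 i hi, fun i => ha ▸ h.2 i⟩

namespace PolyComp

variable {f g : Mem → ℕ}

theorem const (c : ℕ) : PolyComp fun _ => c := by
  refine ⟨fun _ _ _ _ => rfl, fun _ => c + 1, .const _, fun _ _ _ => by dsimp only; omega,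
    fun d hd => ⟨.const d c, fun m V _ => (RunsTo.const ?_).mono (by dsimp only; omega) fun _ h => h⟩⟩
  exact ⟨fun r hr => by simp [hr.ne], rfl, by simp⟩

theorem reg {x : ℕ} (hx : x < 4) : PolyComp fun m => m.reg x := by
  refine ⟨fun _ _ h _ => h x hx, fun V => V + 2, .add .id (.const 2), fun m V h => ?_, fun d hd =>
    ⟨.seq (.const d 0) (.add d x d), fun m V _ => (RunsTo.const_seq (.add ?_)).mono
      (by dsimp only; omega) fun _ h => h⟩⟩
  · have := h.1 x hx
    dsimp only; omega
  · refine ⟨fun r hr => by simp [hr.ne], rfl, by simp [show x ≠ d by omega]⟩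

/-- Two functions are computed one after the other, and combined by a program `q`. -/
theorem binary {o : ℕ → ℕ → ℕ} (hf : PolyComp f) (hg : PolyComp g) (h : ℕ → ℕ)
    (hh : PolyBounded h)
    (ho : ∀ a b V, a ≤ V → b ≤ V → o a b ≤ h V)
    (q : ℕ → Prog)
    (hq : ∀ d m a b V, m.reg d = a → m.reg (d + 1) = b → a ≤ V → b ≤ V →
      RunsTo (q d) m (h V) fun m' =>
        (∀ r < d, m'.reg r = m.reg r) ∧ m'.arr = m.arr ∧ m'.reg d = o a b) :
    PolyComp fun m => o (f m) (g m) := by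
  obtain ⟨cf, bf, hbf, vf, pf⟩ := hf
  obtain ⟨cg, bg, hbg, vg, pg⟩ := hg
  refine ⟨fun m m' h₁ h₂ => by simp only [cf m m' h₁ h₂, cg m m' h₁ h₂],
    fun V => bf V + (bg V + h (bf V + bg V)),
    hbf.add (hbg.add (hh.comp (hbf.add hbg))), fun m V hm => ?_, fun d hd => ?_⟩
  · have := ho (f m) (g m) (bf V + bg V) ((vf m V hm).trans (by omega))
      ((vg m V hm).trans (by omega))
    dsimp only; omega
  · obtain ⟨p₁, hp₁⟩ := pf d hd
    obtain ⟨p₂, hp₂⟩ := pg (d + 1) (by omega)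
    refine ⟨.seq p₁ (.seq p₂ (q d)), fun m V hm => (hp₁ m V hm).seq ?_⟩
    rintro m₁ ⟨r₁, a₁, e₁⟩
    have hm₁ : m₁.Le V := hm.congr (fun i hi => r₁ i (by omega)) (congrFun a₁ 0)
    refine (hp₂ m₁ V hm₁).seq ?_
    rintro m₂ ⟨r₂, a₂, e₂⟩
    have hgm : g m₁ = g m := cg _ _ (fun i hi => r₁ i (by omega)) (congrFun a₁ 0)
    refine (hq d m₂ (f m) (g m) (bf V + bg V) (by rw [r₂ d (by omega), e₁]) (by rw [e₂, hgm])
      ((vf m V hm).trans (by omega)) ((vg m V hm).trans (by omega))).mono le_rfl ?_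
    rintro m₃ ⟨r₃, a₃, e₃⟩
    exact ⟨fun r hr => by rw [r₃ r hr, r₂ r (by omega), r₁ r hr], by rw [a₃, a₂, a₁], e₃⟩

theorem add (hf : PolyComp f) (hg : PolyComp g) : PolyComp fun m => f m + g m :=
  hf.binary (o := (· + ·)) hg (fun V => V + V + 1) ((PolyBounded.id.add .id).add (.const 1))
    (fun a b V _ _ => by omega)
    (fun d => .add d d (d + 1)) fun d m a b V ha hb _ _ =>
      (RunsTo.add ⟨fun r hr => by simp [hr.ne], rfl, by simp [ha, hb]⟩).mono (by omega)
        fun _ h => h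

theorem sub (hf : PolyComp f) (hg : PolyComp g) : PolyComp fun m => f m - g m :=
  hf.binary (o := (· - ·)) hg (fun V => V + 1) (PolyBounded.id.add (.const 1))
    (fun a b V _ _ => by omega)
    (fun d => .sub d d (d + 1)) fun d m a b V ha hb _ _ =>
      (RunsTo.sub ⟨fun r hr => by simp [hr.ne], rfl, by simp [ha, hb]⟩).mono (by omega)
        fun _ h => h

/-- Repeated addition. The loop counts register `d` down to `0`, so the final addition of registers
`d + 2` and `d` merely moves the result. -/
theorem mul (hf : PolyComp f) (hg : PolyComp g) : PolyComp fun m => f m * g m := by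
  refine hf.binary (o := (· * ·)) hg (fun V => V * V + (V * (1 + 2) + 4))
    ((PolyBounded.id.mul .id).add ((PolyBounded.id.mul (.const _)).add (.const _)))
    (fun a b V ha hb => (Nat.mul_le_mul ha hb).trans (by omega))
    (fun d => .seq (.const (d + 2) 0) (.seq (.const (d + 3) 1)
      (.seq (Prog.times d (d + 3) (.add (d + 2) (d + 2) (d + 1))) (.add d (d + 2) d))))
    fun d m a b V ha hb haV hbV => ?_
  have key := (RunsTo.times (r := d) (one := d + 3) (p := .add (d + 2) (d + 2) (d + 1))
    (τ := 1) (N := a) (by omega)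
    (fun i m' => (∀ r < d, m'.reg r = m.reg r) ∧ m'.arr = m.arr ∧ m'.reg (d + 1) = b ∧
      m'.reg (d + 2) = i * b)
    (fun i m' v h => ⟨fun r hr => by simp [hr.ne, h.1 r hr], h.2.1, by simp [h.2.2.1],
      by simp [h.2.2.2]⟩)
    (fun i m' hi h h1 => RunsTo.add ⟨⟨fun r hr => by
        simp [show r ≠ d + 2 by omega, h.1 r hr], h.2.1, by simp [h.2.2.1],
        by simp [h.2.2.1, h.2.2.2, Nat.succ_mul]⟩, by simp [h1], by simp⟩)
    (m := (m.setReg (d + 2) 0).setReg (d + 3) 1)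
    ⟨fun r hr => by simp [show r ≠ d + 2 by omega, show r ≠ d + 3 by omega], rfl,
      by simp [hb], by simp⟩ (by simp) (by simp [ha])).seq (q := .add d (d + 2) d) (τ' := 1)
      (Q' := fun m' => (∀ r < d, m'.reg r = m.reg r) ∧ m'.arr = m.arr ∧ m'.reg d = a * b)
      fun m' ⟨h, h0⟩ => RunsTo.add ⟨fun r hr => by simp [hr.ne, h.1 r hr], h.2.1,
        by simp [h0, h.2.2.2]⟩
  refine (RunsTo.const_seq (RunsTo.const_seq key)).mono ?_ fun _ h => h
  have : a * (1 + 2) ≤ V * (1 + 2) := Nat.mul_le_mul_right _ haV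
  omega

/-- Counting up to `a`, registers `d + 2` and `d + 4` maintain quotient and remainder by `b`; the
remainder is reset when it reaches `b`. Equality is tested by the sum of the two truncated
differences. For `b = 0` no reset occurs, in agreement with `i / 0 = 0` and `i % 0 = i`. -/
theorem div (hf : PolyComp f) (hg : PolyComp g) : PolyComp fun m => f m / g m := by
  refine hf.binary (o := (· / ·)) hg (fun V => V * (8 + 2) + 6)
    ((PolyBounded.id.mul (.const _)).add (.const _))
    (fun a b V ha hb => (Nat.div_le_self a b).trans (by omega))
    (fun d => .seq (.const (d + 2) 0) (.seq (.const (d + 3) 1) (.seq (.const (d + 4) 0)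
      (.seq (Prog.times d (d + 3) (.seq (.add (d + 4) (d + 4) (d + 3))
          (.seq (.sub (d + 5) (d + 1) (d + 4)) (.seq (.sub (d + 6) (d + 4) (d + 1))
          (.seq (.add (d + 5) (d + 5) (d + 6)) (.ite (d + 5) (.const (d + 5) 0)
            (.seq (.const (d + 4) 0) (.add (d + 2) (d + 2) (d + 3)))))))))
        (.add d (d + 2) d)))))
    fun d m a b V ha hb haV hbV => ?_
  have key := (RunsTo.times (r := d) (one := d + 3) (p := .seq (.add (d + 4) (d + 4) (d + 3))
          (.seq (.sub (d + 5) (d + 1) (d + 4)) (.seq (.sub (d + 6) (d + 4) (d + 1))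
          (.seq (.add (d + 5) (d + 5) (d + 6)) (.ite (d + 5) (.const (d + 5) 0)
            (.seq (.const (d + 4) 0) (.add (d + 2) (d + 2) (d + 3))))))))
    (τ := 8) (N := a) (by omega)
    (fun i m' => (∀ r < d, m'.reg r = m.reg r) ∧ m'.arr = m.arr ∧ m'.reg (d + 1) = b ∧
      m'.reg (d + 2) = i / b ∧ m'.reg (d + 4) = i % b)
    (fun i m' v h => ⟨fun r hr => by simp [hr.ne, h.1 r hr], h.2.1, by simp [h.2.2.1],
      by simp [h.2.2.2.1], by simp [h.2.2.2.2]⟩)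
    (fun i m' hi h h1 => by
      obtain ⟨hr, harr, hb', hq, hm⟩ := h
      have hr' : ∀ r < d, r ≠ d + 2 ∧ r ≠ d + 4 ∧ r ≠ d + 5 ∧ r ≠ d + 6 := by omega
      refine (RunsTo.add_seq (RunsTo.sub_seq (RunsTo.sub_seq (RunsTo.add_seq (RunsTo.ite (τ := 2)
        (fun hne => (RunsTo.const ?_).mono one_le_two fun _ h => h)
        (fun heq => (RunsTo.const_seq (RunsTo.add ?_)))))))).mono (by norm_num) fun _ h => h
      · simp only [Mem.setReg_reg, h1, hm, hb'] at hne
        simp at hne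
        have hne' : i % b + 1 ≠ b := by omega
        refine ⟨⟨fun r hrd => ?_, harr, by simp [hb'], ?_, ?_⟩, by simp [h1], by simp⟩
        · obtain ⟨e1, e2, e3, e4⟩ := hr' r hrd
          simp [e2, e3, e4, hr r hrd]
        · simp only [Mem.setReg_reg]
          simp [hq]
          rcases Nat.eq_zero_or_pos b with rfl | hb0
          · simp
          · rw [Nat.succ_div, if_neg]
            · rfl
            · intro hd
              obtain ⟨c, hc⟩ := hd
              have := Nat.div_add_mod i b
              have h3 := Nat.mod_lt i hb0
              have h4 : b * (i / b) < b * c := by omega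
              have h5 : i / b + 1 ≤ c := Nat.lt_of_mul_lt_mul_left h4
              have h6 := Nat.mul_le_mul_left b h5
              rw [Nat.mul_add, Nat.mul_one] at h6
              omega
        · simp only [Mem.setReg_reg]
          simp [hm, h1]
          rcases Nat.eq_zero_or_pos b with rfl | hb0
          · simp
          · have h3 := Nat.mod_lt i hb0
            rw [← Nat.mod_add_mod i b 1, Nat.mod_eq_of_lt (show i % b + 1 < b by omega)]
      · simp only [Mem.setReg_reg, h1, hm, hb'] at heq
        simp at heq
        have heq' : i % b + 1 = b := by omega
        have hi' : i + 1 = b * (i / b + 1) := by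
          have := Nat.div_add_mod i b
          rw [Nat.mul_add]; omega
        have hb0 : 0 < b := by omega
        refine ⟨⟨fun r hrd => ?_, harr, by simp [hb'], ?_, ?_⟩, by simp [h1], by simp⟩
        · obtain ⟨e1, e2, e3, e4⟩ := hr' r hrd
          simp [e1, e2, e3, e4, hr r hrd]
        · simp only [Mem.setReg_reg]
          simp [hq, h1]
          rw [hi', Nat.mul_div_cancel_left _ hb0]
        · simp only [Mem.setReg_reg]
          simp
          rw [hi', Nat.mul_mod_right])
    (m := ((m.setReg (d + 2) 0).setReg (d + 3) 1).setReg (d + 4) 0)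
    ⟨fun r hr => by simp [show r ≠ d + 2 by omega, show r ≠ d + 3 by omega,
      show r ≠ d + 4 by omega], rfl, by simp [hb], by simp, by simp⟩ (by simp)
      (by simp [ha])).seq (q := .add d (d + 2) d) (τ' := 1)
      (Q' := fun m' => (∀ r < d, m'.reg r = m.reg r) ∧ m'.arr = m.arr ∧ m'.reg d = a / b)
      fun m' ⟨h, h0⟩ => RunsTo.add ⟨fun r hr => by simp [hr.ne, h.1 r hr], h.2.1,
        by simp [h0, h.2.2.2.1]⟩
  refine (RunsTo.const_seq (RunsTo.const_seq (RunsTo.const_seq key))).mono ?_ fun _ h => h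
  have : a * (8 + 2) ≤ V * (8 + 2) := Nat.mul_le_mul_right _ haV
  omega

theorem mod (hf : PolyComp f) (hg : PolyComp g) : PolyComp fun m => f m % g m := by
  have := hf.sub (hg.mul (hf.div hg))
  simpa only [Nat.mod_eq_sub_mul_div] using this

theorem pow (hf : PolyComp f) (n : ℕ) : PolyComp fun m => f m ^ n := by
  induction n with
  | zero => simpa using const 1
  | succ n ih => simpa only [pow_succ] using ih.mul hf

theorem sum_fin {n : ℕ} {f : Fin n → Mem → ℕ} (hf : ∀ i, PolyComp (f i)) :
    PolyComp fun m => ∑ i, f i m := by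
  induction n with
  | zero => simpa using const 0
  | succ n ih =>
    simp only [Fin.sum_univ_succ]
    exact (hf 0).add (ih fun i => hf i.succ)

/-- Reading a cell of array `0`. -/
theorem cell (hf : PolyComp f) : PolyComp fun m => m.arr 0 (f m) := by
  obtain ⟨cf, bf, hbf, vf, pf⟩ := hf
  refine ⟨fun m m' h₁ h₂ => by simp only [cf m m' h₁ h₂, h₂],
    fun V => bf V + 1 + V, (hbf.add (.const 1)).add .id, fun m V hm => ?_, fun d hd => ?_⟩
  · have := hm.2 (f m)
    dsimp only; omega
  · obtain ⟨p₁, hp₁⟩ := pf d hd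
    refine ⟨.seq p₁ (.load d 0 d), fun m V hm => ((hp₁ m V hm).seq (τ' := 1)
      (Q' := fun m' => (∀ r < d, m'.reg r = m.reg r) ∧ m'.arr = m.arr ∧
        m'.reg d = m.arr 0 (f m)) ?_).mono (by dsimp only; omega) fun _ h => h⟩
    rintro m₁ ⟨r₁, a₁, e₁⟩
    exact RunsTo.load ⟨fun r hr => by simp [hr.ne, r₁ r hr], a₁, by simp [e₁, a₁]⟩

/-- Bounded sums; the summation variable is held in register `x`. -/
theorem sum_range (hf : PolyComp f) (hg : PolyComp g) {x : ℕ} (hx : x < 4) :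
    PolyComp fun m => ∑ b ∈ Finset.range (g m), f (m.setReg x b) := by
  obtain ⟨cf, bf, hbf, vf, pf⟩ := hf
  obtain ⟨cg, bg, hbg, vg, pg⟩ := hg
  -- The summation variable may exceed `V`, so the summands are evaluated under the larger bound `V
  -- + bg V`.
  have hLe : ∀ (m : Mem) V b, m.Le V → b ≤ g m → (m.setReg x b).Le (V + bg V) := by
    intro m V b hm hb
    refine ⟨fun i hi => ?_, fun i => (hm.2 i).trans (by omega)⟩
    simp only [Mem.setReg_reg]
    have := hm.1 i hi
    have := vg m V hm
    split_ifs <;> omega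
  refine ⟨fun m m' h₁ h₂ => ?_,
    fun V => bg V * bf (V + bg V) + (bg V + (bg V * (bf (V + bg V) + 2 + 2) + 8)),
    (hbg.mul (hbf.comp (PolyBounded.id.add hbg))).add (hbg.add
      ((hbg.mul (((hbf.comp (PolyBounded.id.add hbg)).add (.const _)).add (.const _))).add
        (.const _))),
    fun m V hm => ?_, fun d hd => ?_⟩
  · dsimp only
    rw [cg m m' h₁ h₂]
    refine Finset.sum_congr rfl fun b _ => cf _ _ (fun i hi => ?_) h₂
    simp [h₁ i hi]
  · calc ∑ b ∈ Finset.range (g m), f (m.setReg x b)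
        ≤ ∑ b ∈ Finset.range (g m), bf (V + bg V) := Finset.sum_le_sum fun b hb =>
          vf _ _ (hLe m V b hm (Finset.mem_range.1 hb).le)
      _ = g m * bf (V + bg V) := by simp
      _ ≤ bg V * bf (V + bg V) := Nat.mul_le_mul_right _ (vg m V hm)
      _ ≤ _ := by dsimp only; omega
  · obtain ⟨pB, hpB⟩ := pg d hd
    obtain ⟨pF, hpF⟩ := pf (d + 4) (by omega)
    -- Register `x` lies below `d` and must be preserved: it is saved in `d + 2` and restored after
    -- the loop. The summand is computed in `d + 4`, above the accumulator and the loop data.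
    refine ⟨.seq pB (.seq (.const (d + 1) 0) (.seq (.add (d + 2) x (d + 1))
      (.seq (.const (d + 3) 1) (.seq (.const x 0) (.seq
        (Prog.times d (d + 3) (.seq pF (.seq (.add (d + 1) (d + 1) (d + 4)) (.add x x (d + 3)))))
        (.seq (.add x (d + 2) d) (.add d (d + 1) d))))))), fun m V hm =>
      ((hpB m V hm).seq (τ' := (bg V * (bf (V + bg V) + 2 + 2) + 8)) ?_).mono (by dsimp only; omega)
        fun _ h => h⟩
    rintro m₁ ⟨r₁, a₁, e₁⟩
    have hr' : ∀ r < d, r ≠ d + 1 ∧ r ≠ d + 2 ∧ r ≠ d + 3 := by omega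
    have key := (RunsTo.times (r := d) (one := d + 3)
      (p := (.seq pF (.seq (.add (d + 1) (d + 1) (d + 4)) (.add x x (d + 3)))))
      (τ := bf (V + bg V) + 2) (N := g m) (by omega)
      (fun i m' => (∀ r < d, r ≠ x → m'.reg r = m.reg r) ∧ m'.arr = m.arr ∧ m'.reg x = i ∧
        m'.reg (d + 1) = ∑ b ∈ Finset.range i, f (m.setReg x b) ∧ m'.reg (d + 2) = m.reg x)
      (fun i m' v h => ⟨fun r hr hrx => by simp [hr.ne, h.1 r hr hrx], h.2.1,
        by simp [show x ≠ d by omega, h.2.2.1], by simp [h.2.2.2.1], by simp [h.2.2.2.2]⟩)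
      (fun i m' hi h h1 => by
        obtain ⟨hr, harr, hxi, hs, hsave⟩ := h
        have hreg : ∀ j < 4, m'.reg j = (m.setReg x i).reg j := by
          intro j hj
          by_cases hjx : j = x
          · simp [hjx, hxi]
          · simp [hjx, hr j (by omega) hjx]
        have hm' : m'.Le (V + bg V) := (hLe m V i hm hi.le).congr hreg (congrFun harr 0)
        refine (hpF m' _ hm').seq ?_
        rintro m₂ ⟨r₂, a₂, e₂⟩
        refine RunsTo.add_seq (RunsTo.add ⟨⟨fun r hrd hrx => ?_, ?_, ?_, ?_, ?_⟩, ?_, ?_⟩)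
        · simp [hrx, (hr' r hrd).1, r₂ r (by omega), hr r hrd hrx]
        · simp [a₂, harr]
        · simp [show x ≠ d + 1 by omega, r₂ x (by omega), hxi, r₂ (d + 3) (by omega), h1]
        · simp [show d + 1 ≠ x by omega, r₂ (d + 1) (by omega), hs, e₂, Finset.sum_range_succ,
            cf m' (m.setReg x i) hreg (congrFun harr 0)]
        · simp [show d + 2 ≠ x by omega, r₂ (d + 2) (by omega), hsave]
        · simp [show d + 3 ≠ x by omega, r₂ (d + 3) (by omega), h1]
        · simp [show d ≠ x by omega, r₂ d (by omega)])
      (m := (((m₁.setReg (d + 1) 0).setReg (d + 2) (m.reg x)).setReg (d + 3) 1).setReg x 0)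
      ⟨fun r hr hrx => by simp [hrx, hr' r hr, r₁ r hr], a₁, by simp,
        by simp [show d + 1 ≠ x by omega], by simp [show d + 2 ≠ x by omega]⟩
      (by simp [show d + 3 ≠ x by omega]) (by simp [show d ≠ x by omega, e₁])).seq
      (q := .seq (.add x (d + 2) d) (.add d (d + 1) d)) (τ' := 2)
      (Q' := fun m' => (∀ r < d, m'.reg r = m.reg r) ∧ m'.arr = m.arr ∧
        m'.reg d = ∑ b ∈ Finset.range (g m), f (m.setReg x b))
      fun m' ⟨h, h0⟩ => by
        obtain ⟨hr, harr, hxi, hs, hsave⟩ := h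
        refine RunsTo.add_seq (RunsTo.add ⟨fun r hrd => ?_, harr, ?_⟩)
        · by_cases hrx : r = x
          · simp [hrx, show x ≠ d by omega, hsave, h0]
          · simp [hrx, hrd.ne, hr r hrd hrx]
        · simp [show d + 1 ≠ x by omega, show d ≠ x by omega, hs, h0]
    have hmx : m₁.reg x = m.reg x := r₁ x (by omega)
    refine (RunsTo.const_seq (RunsTo.add_seq (RunsTo.const_seq (RunsTo.const_seq
      (τ := (g m * (bf (V + bg V) + 2 + 2) + 1 + 2)) ?_)))).mono ?_ fun _ h => h
    · convert key using 5
      simp [show x ≠ d + 1 by omega, hmx]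
    · have : g m * (bf (V + bg V) + 2 + 2) ≤ bg V * (bf (V + bg V) + 2 + 2) :=
        Nat.mul_le_mul_right _ (vg m V hm)
      omega

end PolyComp

/-! ### Predicates on the memory decidable in polynomial time -/

open Classical in
/-- The characteristic function of `P` is computable in polynomial time. -/
def PolyDec (P : Mem → Prop) : Prop := PolyComp fun m => if P m then 1 else 0

namespace PolyDec

variable {P Q : Mem → Prop} {f g : Mem → ℕ}

theorem congr (h : PolyDec P) (hPQ : ∀ m, Q m ↔ P m) : PolyDec Q := by
  obtain rfl : P = Q := funext fun m => propext (hPQ m).symm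
  exact h

/-- With truncated subtraction, `1 - (1 - f)` is the characteristic function of `0 < f`. -/
theorem pos (hf : PolyComp f) : PolyDec fun m => 0 < f m := by
  have := (PolyComp.const 1).sub ((PolyComp.const 1).sub hf)
  unfold PolyDec
  convert this using 2 with m
  split_ifs <;> omega

theorem lt (hf : PolyComp f) (hg : PolyComp g) : PolyDec fun m => f m < g m :=
  (pos (hg.sub hf)).congr fun m => by omega

theorem not (hP : PolyDec P) : PolyDec fun m => ¬ P m :=
  (pos ((PolyComp.const 1).sub hP)).congr fun m => by split_ifs <;> simp_all

theorem or (hP : PolyDec P) (hQ : PolyDec Q) : PolyDec fun m => P m ∨ Q m :=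
  (pos (PolyComp.add hP hQ)).congr fun m => by split_ifs <;> simp_all

theorem and (hP : PolyDec P) (hQ : PolyDec Q) : PolyDec fun m => P m ∧ Q m :=
  (hP.not.or hQ.not).not.congr fun m => by tauto

theorem imp (hP : PolyDec P) (hQ : PolyDec Q) : PolyDec fun m => P m → Q m :=
  (hP.not.or hQ).congr fun m => by tauto

theorem eq (hf : PolyComp f) (hg : PolyComp g) : PolyDec fun m => f m = g m :=
  ((lt hf hg).or (lt hg hf)).not.congr fun m => by omega

theorem le (hf : PolyComp f) (hg : PolyComp g) : PolyDec fun m => f m ≤ g m :=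
  (lt hg hf).not.congr fun m => by omega

theorem exists_fin {n : ℕ} {P : Fin n → Mem → Prop} (hP : ∀ i, PolyDec (P i)) :
    PolyDec fun m => ∃ i, P i m :=
  (pos (PolyComp.sum_fin hP)).congr fun m => by simp [Finset.filter_nonempty_iff]

theorem forall_fin {n : ℕ} {P : Fin n → Mem → Prop} (hP : ∀ i, PolyDec (P i)) :
    PolyDec fun m => ∀ i, P i m :=
  (exists_fin fun i => (hP i).not).not.congr fun m => by simp

/-- Bounded quantification; the quantified variable is held in register `x`. -/
theorem exists_lt (hP : PolyDec P) (hg : PolyComp g) {x : ℕ} (hx : x < 4) :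
    PolyDec fun m => ∃ b < g m, P (m.setReg x b) :=
  (pos (PolyComp.sum_range hP hg hx)).congr fun m => by simp [Finset.filter_nonempty_iff]

theorem ite [DecidablePred P] (hP : PolyDec P) (hf : PolyComp f) (hg : PolyComp g) :
    PolyComp fun m => if P m then f m else g m := by
  have := (PolyComp.mul hP hf).add (PolyComp.mul hP.not hg)
  convert this using 2 with m
  split_ifs <;> simp_all

end PolyDec

/-! ### The graph of a multicoloured hitting set instance -/

section Gadget

variable {V : Type} (tag cls : V → ℕ) (hit : V → V → Prop)

/-- Half of the adjacency relation of `gadget`. -/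
def GadgetRel (x y : V) : Prop :=
  (tag x = 0 ∧ tag y = 0) ∨ (2 ≤ tag x ∧ 2 ≤ tag y) ∨
    (tag x ≤ 1 ∧ tag y ≤ 1 ∧ cls x = cls y) ∨ (tag x = 0 ∧ 2 ≤ tag y ∧ hit x y)

/-- The vertices of tag `0` are the elements, partitioned into classes; the vertices of tag at
least `2` are the sets to be hit. Both form a clique. The vertices of tag `1` in a class form a
clique and are adjacent to the elements of that class. -/
def gadget : SimpleGraph V where
  Adj x y := x ≠ y ∧ (GadgetRel tag cls hit x y ∨ GadgetRel tag cls hit y x)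
  symm := ⟨fun _ _ h => ⟨h.1.symm, h.2.symm⟩⟩
  loopless := ⟨fun _ h => h.1 rfl⟩

/-- Pigeonhole on the tags `0`, `1` and at least `2`: two of the at least four leaves fall into the
same group. The first and third groups are cliques. Two leaves of tag `1` both have the class of the
centre, so they are adjacent as well. -/
theorem gadget_clawFree {t : ℕ} (ht : 4 ≤ t) : ClawFree t (gadget tag cls hit) := by
  rintro ⟨φ⟩
  have hinj := φ.injective
  have hadj : ∀ i, (gadget tag cls hit).Adj (φ (.inl 0)) (φ (.inr i)) := fun i =>
    φ.map_rel_iff.2 (by simp)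
  have hnadj : ∀ i j, ¬ (gadget tag cls hit).Adj (φ (.inr i)) (φ (.inr j)) := fun i j h => by
    have := φ.map_rel_iff.1 h
    simp at this
  obtain ⟨i, j, hij, he⟩ := Fintype.exists_ne_map_eq_of_card_lt
    (fun i : Fin t => (⟨min (tag (φ (.inr i))) 2, by omega⟩ : Fin 3)) (by simp; omega)
  have hne : φ (.inr i) ≠ φ (.inr j) := fun h => hij (by simpa using hinj h)
  have hi := hadj i
  have hj := hadj j
  have hn := hnadj i j
  simp only [Fin.mk.injEq] at he
  refine hn ⟨hne, ?_⟩
  by_cases h1 : tag (φ (.inr i)) = 1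
  · have h2 : tag (φ (.inr j)) = 1 := by omega
    obtain ⟨_, hi⟩ := hi
    obtain ⟨_, hj⟩ := hj
    simp only [GadgetRel, h1, h2] at hi hj ⊢
    simp at hi hj ⊢
    omega
  · by_cases h0 : tag (φ (.inr i)) = 0
    · exact .inl (.inl ⟨h0, by omega⟩)
    · exact .inl (.inr (.inl ⟨by omega, by omega⟩))

variable {tag cls hit}

/-- A dominating set that is not larger than the number of classes contains at most one element of
each class, and its elements hit all sets. -/
theorem gadget_elements_of_dominating {K : ℕ} (hK : ∀ J < K, ∃ x, tag x = 1 ∧ cls x = J)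
    {D : Finset V} (hD : IsDominatingSet (gadget tag cls hit) D) (hcard : D.card ≤ K) :
    Set.InjOn cls (D : Set V) ∧ ∀ y, 2 ≤ tag y → ∃ x ∈ D, tag x = 0 ∧ hit x y := by
  classical
  -- All neighbours of a tag-`1` vertex have its class and tag at most `1`, so `D` meets this part
  -- of every class.
  have hsurj : Finset.range K ⊆ (D.filter fun x => tag x ≤ 1).image cls := by
    intro J hJ
    obtain ⟨p, hp, rfl⟩ := hK J (Finset.mem_range.1 hJ)
    simp only [Finset.mem_image, Finset.mem_filter]
    by_cases hpD : p ∈ D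
    · exact ⟨p, ⟨hpD, hp.le⟩, rfl⟩
    · obtain ⟨u, hu, -, h⟩ := hD p (by simpa using hpD)
      simp only [GadgetRel, hp] at h
      refine ⟨u, ⟨by simpa using hu, ?_⟩, ?_⟩ <;> omega
  have h1 := Finset.card_le_card hsurj
  have h2 : ((D.filter fun x => tag x ≤ 1).image cls).card ≤ (D.filter fun x => tag x ≤ 1).card :=
    Finset.card_image_le
  -- Covering `K` classes uses up all of the at most `K` vertices, leaving none of tag at least `2`
  -- in `D`.
  have h3 : (D.filter fun x => tag x ≤ 1) = D :=
    Finset.eq_of_subset_of_card_le (Finset.filter_subset _ _) (by simp at h1; omega)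
  rw [h3] at h1 h2
  refine ⟨Finset.card_image_iff.1 (by simp at h1; omega), fun y hy => ?_⟩
  have hyD : y ∉ D := fun h => by
    rw [← h3, Finset.mem_filter] at h
    omega
  obtain ⟨u, hu, -, h⟩ := hD y (by simpa using hyD)
  have hu' : u ∈ D := by simpa using hu
  have hu1 := hu'
  rw [← h3, Finset.mem_filter] at hu1
  simp only [GadgetRel] at h
  refine ⟨u, hu', by omega, ?_⟩
  rcases h with (h | h | h | h) | (h | h | h | h) <;> first | omega | exact h.2.2

/-- One element of each class, such that all sets are hit, form a dominating clique. -/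
theorem gadget_dominating_of_elements {K : ℕ} (hK : 0 < K) (hcls : ∀ x, cls x < K) (e : Fin K → V)
    (he : ∀ J, tag (e J) = 0 ∧ cls (e J) = J) (hhit : ∀ y, 2 ≤ tag y → ∃ J, hit (e J) y) :
    ∃ D : Finset V, D.card ≤ K ∧ IsDominatingSet (gadget tag cls hit) D ∧
      (gadget tag cls hit).IsClique (D : Set V) ∧ D.Nonempty := by
  classical
  refine ⟨Finset.univ.image e, Finset.card_image_le.trans (by simp), fun v hv => ?_, ?_,
    ⟨e ⟨0, hK⟩, by simp⟩⟩
  · have hne : ∀ J, e J ≠ v := by simpa using hv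
    have key : ∃ J, GadgetRel tag cls hit (e J) v := by
      -- A vertex of tag at most `1` is dominated by the selected element of its own class, a set
      -- vertex by an element hitting it.
      by_cases h0 : tag v ≤ 1
      · exact ⟨⟨cls v, hcls v⟩, .inr (.inr (.inl ⟨by simp [he], h0, by simp [he]⟩))⟩
      · obtain ⟨J, hJ⟩ := hhit v (by omega)
        exact ⟨J, .inr (.inr (.inr ⟨(he J).1, by omega, hJ⟩))⟩
    obtain ⟨J, hJ⟩ := key
    exact ⟨e J, by simp, hne J, .inl hJ⟩
  · intro x hx y hy hxy
    simp only [Finset.coe_image, Finset.coe_univ, Set.image_univ, Set.mem_range] at hx hy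
    obtain ⟨J, rfl⟩ := hx
    obtain ⟨J', rfl⟩ := hy
    exact ⟨hxy, .inl (.inl ⟨(he J).1, (he J').1⟩)⟩

theorem _root_.SimpleGraph.IsClique.connected_induce {V : Type*} {G : SimpleGraph V} {s : Set V}
    (h : G.IsClique s) (hs : s.Nonempty) : (G.induce s).Connected := by
  have : Nonempty s := hs.to_subtype
  rw [← SimpleGraph.induce_eq_top] at h
  rw [h]
  exact SimpleGraph.connected_top

end Gadget

/-! ### Digits -/

/-- The digit at position `i` of `x` in base `b`. -/
def digit (b x i : ℕ) : ℕ := x / b ^ i % b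

theorem digit_lt {b : ℕ} (hb : 0 < b) (x i : ℕ) : digit b x i < b := Nat.mod_lt _ hb

/-- `finFunctionFinEquiv` is base-`b` expansion, and its inverse reads digits by the formula that
defines `digit`. -/
theorem exists_digit_eq {b c : ℕ} (f : Fin c → ℕ) (hf : ∀ i, f i < b) :
    ∃ x < b ^ c, ∀ i : Fin c, digit b x i = f i := by
  let F : Fin c → Fin b := fun i => ⟨f i, hf i⟩
  refine ⟨finFunctionFinEquiv F, (finFunctionFinEquiv F).2, fun i => ?_⟩
  exact congrArg Fin.val (congrFun (finFunctionFinEquiv.symm_apply_apply F) i)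

/-! ### Codes of tuples -/

/-- The tuple `g` as a number in base `n`. -/
def code (n : ℕ) {s : ℕ} (g : Fin s → ℕ) : ℕ := ∑ i, g i * n ^ (i : ℕ)

theorem code_val {n s : ℕ} (g : Fin s → Fin n) :
    code n (fun i => (g i : ℕ)) = (finFunctionFinEquiv g : ℕ) := rfl

theorem code_lt {n s : ℕ} (g : Fin s → Fin n) : code n (fun i => (g i : ℕ)) < n ^ s := by
  rw [code_val]
  exact (finFunctionFinEquiv g).2

theorem code_injective {n s : ℕ} :
    Function.Injective fun g : Fin s → Fin n => code n fun i => (g i : ℕ) := by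
  intro g g' h
  simp only [code_val] at h
  exact finFunctionFinEquiv.injective (Fin.ext h)

theorem exists_code_eq {n s t : ℕ} (ht : t < n ^ s) :
    ∃ g : Fin s → Fin n, code n (fun i => (g i : ℕ)) = t :=
  ⟨finFunctionFinEquiv.symm ⟨t, ht⟩, by rw [code_val, Equiv.apply_symm_apply]⟩

/-! ### Local certificates for quantifier-free formulas -/

/-- The number of occurrences of the relation variable. -/
def QFFormula.numX {m : ℕ} {ar : Fin m → ℕ} {s : ℕ} {V : Type} : QFFormula ar s V → ℕ
  | .eq _ _ => 0
  | .rel _ _ => 0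
  | .X _ => 1
  | .not ψ => ψ.numX
  | .and ψ χ => ψ.numX + χ.numX
  | .or ψ χ => ψ.numX + χ.numX

/-- Part of an enumeration `σ 0 < σ 1 < …` of the codes of the tuples in the relation variable
(increased by one), given by the values `u i` of `σ` at `J i`, suffices to see that the formula has
the truth value `b`. The structure is given by the table `inp`, the one of `r` starting at
`off r`. -/
def QFFormula.Cert {m : ℕ} {ar : Fin m → ℕ} {s : ℕ} {V : Type} (inp : ℕ → ℕ) (off : Fin m → ℕ)
    (n : ℕ) {c : ℕ} (J u : Fin c → ℕ) (val : V → ℕ) : QFFormula ar s V → Bool → Prop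
  | .eq v w, true => val v = val w
  | .eq v w, false => ¬ val v = val w
  | .rel r args, true => inp (off r + code n fun i => val (args i)) = 2
  | .rel r args, false => ¬ inp (off r + code n fun i => val (args i)) = 2
  | .X args, true => ∃ i, u i = (code n fun i => val (args i)) + 1
  | .X args, false => ∃ i i', J i' = J i + 1 ∧ u i < (code n fun i => val (args i)) + 1 ∧
      (code n fun i => val (args i)) + 1 < u i'
  | .not ψ, b => ψ.Cert inp off n J u val (!b)
  | .and ψ χ, true => ψ.Cert inp off n J u val true ∧ χ.Cert inp off n J u val true
  | .and ψ χ, false => ψ.Cert inp off n J u val false ∨ χ.Cert inp off n J u val false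
  | .or ψ χ, true => ψ.Cert inp off n J u val true ∨ χ.Cert inp off n J u val true
  | .or ψ χ, false => ψ.Cert inp off n J u val false ∧ χ.Cert inp off n J u val false

/-- `σ 1 < … < σ k` enumerate the codes of the tuples in `S`, increased by one, and `σ 0`,
`σ (k + 1)` are a lower and an upper bound. -/
structure Enumerates {n s : ℕ} (S : Finset (Fin s → Fin n)) (k : ℕ) (σ : ℕ → ℕ) : Prop where
  zero : σ 0 = 0
  last : σ (k + 1) = n ^ s + 1
  lt : ∀ i j, i < j → j ≤ k + 1 → σ i < σ j
  mem : ∀ g, g ∈ S ↔ ∃ j, 1 ≤ j ∧ j ≤ k ∧ σ j = code n (fun i => (g i : ℕ)) + 1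

/-! ### Soundness and completeness of certificates. -/

section Cert

variable {m : ℕ} {ar : Fin m → ℕ} {s : ℕ} {V : Type} {A : FinStruct ar}
  {S : Finset (Fin s → Fin A.size)} {k : ℕ} {σ : ℕ → ℕ} {inp : ℕ → ℕ} {off : Fin m → ℕ}

theorem Enumerates.lt_of_apply_lt {n : ℕ} {S : Finset (Fin s → Fin n)} (h : Enumerates S k σ) {i j : ℕ}
    (hi : i ≤ k + 1) (hlt : σ i < σ j) : i < j := by
  by_contra hij
  rcases (not_lt.1 hij).eq_or_lt with rfl | h'
  · omega
  · have := h.lt j i h' hi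
    omega

/-- Only the occurrences of `X` matter. A value equal to a code plus one cannot be a sentinel, so
its index lies in `1, …, k`; and by monotonicity no value lies strictly between two consecutive
ones. -/
theorem QFFormula.Cert.sound (hσ : Enumerates S k σ)
    (hinp : ∀ r (g : Fin (ar r) → Fin A.size),
      inp (off r + code A.size fun i => (g i : ℕ)) = 2 ↔ A.rel r g = true)
    {c : ℕ} {J : Fin c → ℕ} (hJ : ∀ i, J i ≤ k + 1) (val : V → Fin A.size) :
    ∀ (ψ : QFFormula ar s V) (b : Bool),
      ψ.Cert inp off A.size J (fun i => σ (J i)) (fun v => (val v : ℕ)) b →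
        (ψ.Holds A S val ↔ b = true) := by
  intro ψ
  induction ψ with
  | eq v w => rintro (_ | _) h <;> simp_all [Cert, Holds, Fin.ext_iff]
  | rel r args =>
    have := hinp r fun i => val (args i)
    rintro (_ | _) h <;> simp_all [Cert, Holds]
  | X args =>
    have hmem := hσ.mem fun i => val (args i)
    have hlt := code_lt fun i => val (args i)
    rintro (_ | _) h
    · simp only [Cert] at h
      obtain ⟨i, i', h1, h2, h3⟩ := h
      simp only [Holds, hmem, Bool.false_eq_true, iff_false]
      rintro ⟨j, hj1, hjk, hj⟩
      rw [← hj] at h2 h3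
      have := hσ.lt_of_apply_lt (hJ i) h2
      have := hσ.lt_of_apply_lt (by omega) h3
      omega
    · simp only [Cert] at h
      obtain ⟨i, hi⟩ := h
      simp only [Holds, hmem, iff_true]
      refine ⟨J i, ?_, ?_, hi⟩
      · by_contra hc
        rw [show J i = 0 by omega, hσ.zero] at hi
        omega
      · by_contra hc
        have := hJ i
        rw [show J i = k + 1 by omega, hσ.last] at hi
        omega
  | not ψ ih =>
    intro b h
    have := ih _ h
    cases b <;> simp_all [Holds]
  | and ψ χ ih₁ ih₂ =>
    rintro (_ | _) h
    · rcases h with h | h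
      · have := ih₁ _ h
        simp_all [Holds]
      · have := ih₂ _ h
        simp_all [Holds]
    · have := ih₁ _ h.1
      have := ih₂ _ h.2
      simp_all [Holds]
  | or ψ χ ih₁ ih₂ =>
    rintro (_ | _) h
    · have := ih₁ _ h.1
      have := ih₂ _ h.2
      simp_all [Holds]
    · rcases h with h | h
      · have := ih₁ _ h
        simp_all [Holds]
      · have := ih₂ _ h
        simp_all [Holds]

theorem Enumerates.exists_gap {n : ℕ} {S : Finset (Fin s → Fin n)} (hσ : Enumerates S k σ)
    {g : Fin s → Fin n} (hg : g ∉ S) :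
    ∃ j ≤ k, σ j < code n (fun i => (g i : ℕ)) + 1 ∧
      code n (fun i => (g i : ℕ)) + 1 < σ (j + 1) := by
  have hlt := code_lt g
  set t := code n fun i => (g i : ℕ) with ht
  have h0 : σ 0 < t + 1 := by rw [hσ.zero]; omega
  -- The gap starts at the last index up to `k` whose value is below that of `g`; the next value
  -- cannot equal it because `g ∉ S`.
  have hspec := Nat.findGreatest_spec (P := fun j => σ j < t + 1) (Nat.zero_le k) h0
  have hle := Nat.findGreatest_le (P := fun j => σ j < t + 1) k
  refine ⟨_, hle, hspec, ?_⟩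
  generalize hj : Nat.findGreatest (fun j => σ j < t + 1) k = j at hspec hle
  rcases hle.eq_or_lt with rfl | hjk
  · rw [hσ.last]; omega
  · have h1 : ¬ σ (j + 1) < t + 1 := by
      refine Nat.findGreatest_is_greatest (P := fun j => σ j < t + 1) (n := k) (by omega) hjk
    have h2 : σ (j + 1) ≠ t + 1 := fun h =>
      hg ((hσ.mem g).2 ⟨j + 1, by omega, hjk, h⟩)
    omega

open Classical in
-- Each occurrence of `X` contributes the index of its tuple or the two ends of a gap, whence the
-- bound `2 * ψ.numX`. The required indices may appear in `J` in any order and among others, so the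
-- lists for two subformulas can simply be concatenated.
theorem QFFormula.Cert.complete (hσ : Enumerates S k σ)
    (hinp : ∀ r (g : Fin (ar r) → Fin A.size),
      inp (off r + code A.size fun i => (g i : ℕ)) = 2 ↔ A.rel r g = true)
    (val : V → Fin A.size) (ψ : QFFormula ar s V) :
    ∃ l : List ℕ, l.length ≤ 2 * ψ.numX ∧ (∀ j ∈ l, j ≤ k + 1) ∧
      ∀ {c : ℕ} (J : Fin c → ℕ), (∀ j ∈ l, ∃ i, J i = j) →
        ψ.Cert inp off A.size J (fun i => σ (J i)) (fun v => (val v : ℕ))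
          (decide (ψ.Holds A S val)) := by
  induction ψ with
  | eq v w =>
    refine ⟨[], by simp, by simp, fun J _ => ?_⟩
    by_cases h : (eq v w).Holds A S val <;> simp only [h, decide_true, decide_false] <;>
      simpa [Cert, Holds, Fin.ext_iff] using h
  | rel r args =>
    refine ⟨[], by simp, by simp, fun J _ => ?_⟩
    have := hinp r fun i => val (args i)
    by_cases h : (rel r args).Holds A S val <;> simp only [h, decide_true, decide_false, Cert] <;>
      simpa [Holds, this] using h
  | X args =>
    by_cases h : (X args).Holds A S val
    · obtain ⟨j, hj1, hjk, hj⟩ := (hσ.mem _).1 h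
      refine ⟨[j], by simp [numX], by simp; omega, fun J hJ => ?_⟩
      obtain ⟨i, hi⟩ := hJ j (by simp)
      simp only [h, decide_true, Cert]
      exact ⟨i, by rw [hi, hj]⟩
    · obtain ⟨j, hjk, hj1, hj2⟩ := hσ.exists_gap h
      refine ⟨[j, j + 1], by simp [numX], by simp; omega, fun J hJ => ?_⟩
      obtain ⟨i, hi⟩ := hJ j (by simp)
      obtain ⟨i', hi'⟩ := hJ (j + 1) (by simp)
      simp only [h, decide_false, Cert]
      exact ⟨i, i', by rw [hi, hi'], by rw [hi]; exact hj1, by rw [hi']; exact hj2⟩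
  | not ψ ih =>
    obtain ⟨l, hl, hk, hc⟩ := ih
    refine ⟨l, hl, hk, fun J hJ => ?_⟩
    have := hc J hJ
    by_cases h : ψ.Holds A S val <;> simp_all [Cert, Holds]
  | and ψ χ ih₁ ih₂ =>
    obtain ⟨l, hl, hk, hc⟩ := ih₁
    obtain ⟨l', hl', hk', hc'⟩ := ih₂
    refine ⟨l ++ l', by simp [numX]; omega, fun j hj => ?_, fun J hJ => ?_⟩
    · rcases List.mem_append.1 hj with h | h
      exacts [hk j h, hk' j h]
    · have h1 := hc J fun j hj => hJ j (List.mem_append_left _ hj)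
      have h2 := hc' J fun j hj => hJ j (List.mem_append_right _ hj)
      by_cases h : ψ.Holds A S val <;> by_cases h' : χ.Holds A S val <;>
        simp_all [Cert, Holds]
  | or ψ χ ih₁ ih₂ =>
    obtain ⟨l, hl, hk, hc⟩ := ih₁
    obtain ⟨l', hl', hk', hc'⟩ := ih₂
    refine ⟨l ++ l', by simp [numX]; omega, fun j hj => ?_, fun J hJ => ?_⟩
    · rcases List.mem_append.1 hj with h | h
      exacts [hk j h, hk' j h]
    · have h1 := hc J fun j hj => hJ j (List.mem_append_left _ hj)
      have h2 := hc' J fun j hj => hJ j (List.mem_append_right _ hj)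
      by_cases h : ψ.Holds A S val <;> by_cases h' : χ.Holds A S val <;>
        simp_all [Cert, Holds]

end Cert

/-- Sort the shifted codes together with the two sentinels. The shift by one keeps all codes
strictly between `0` and `n ^ s + 1`. -/
theorem exists_enumerates {n s : ℕ} (S : Finset (Fin s → Fin n)) : ∃ σ, Enumerates S S.card σ := by
  classical
  set t : (Fin s → Fin n) → ℕ := fun g => code n (fun i => (g i : ℕ)) + 1 with ht
  have htinj : Function.Injective t := fun g g' h => code_injective (Nat.succ_injective h)
  have htlt : ∀ g, 0 < t g ∧ t g < n ^ s + 1 := fun g => ⟨by simp [ht], by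
    have := code_lt g
    simp only [ht]; omega⟩
  set T : Finset ℕ := insert 0 (insert (n ^ s + 1) (S.image t)) with hT
  have h1 : n ^ s + 1 ∉ S.image t := fun h => by
    obtain ⟨g, -, hg⟩ := Finset.mem_image.1 h
    have := (htlt g).2
    omega
  have h2 : 0 ∉ insert (n ^ s + 1) (S.image t) := fun h => by
    rcases Finset.mem_insert.1 h with h | h
    · omega
    · obtain ⟨g, -, hg⟩ := Finset.mem_image.1 h
      have := (htlt g).1
      omega
  have hcard : T.card = S.card + 2 := by
    rw [hT, Finset.card_insert_of_notMem h2, Finset.card_insert_of_notMem h1,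
      Finset.card_image_of_injective _ htinj]
  have hle : ∀ x ∈ T, x ≤ n ^ s + 1 := by
    intro x hx
    simp only [hT, Finset.mem_insert, Finset.mem_image] at hx
    rcases hx with rfl | rfl | ⟨g, -, rfl⟩
    · omega
    · omega
    · exact (htlt g).2.le
  set e := T.orderEmbOfFin hcard with he
  have hmem : ∀ x, x ∈ T ↔ ∃ i, e i = x := fun x => by
    have := Finset.range_orderEmbOfFin T hcard
    rw [← Finset.mem_coe, ← this, Set.mem_range]
  have e0 : e ⟨0, by omega⟩ = 0 := by
    obtain ⟨i, hi⟩ := (hmem 0).1 (by simp [hT])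
    have : e ⟨0, by omega⟩ ≤ e i := e.monotone (Fin.mk_le_of_le_val (Nat.zero_le _))
    omega
  have e1 : e ⟨S.card + 1, by omega⟩ = n ^ s + 1 := by
    obtain ⟨i, hi⟩ := (hmem (n ^ s + 1)).1 (by simp [hT])
    have h3 : e i ≤ e ⟨S.card + 1, by omega⟩ := e.monotone (Fin.le_def.2 (by simp; omega))
    have := hle _ ((hmem _).2 ⟨⟨S.card + 1, by omega⟩, rfl⟩)
    omega
  refine ⟨fun j => if h : j < S.card + 2 then e ⟨j, h⟩ else 0, ?_, ?_, ?_, ?_⟩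
  · rw [dif_pos (by omega), e0]
  · simp [e1]
  · intro i j hij hj
    simp only [show i < S.card + 2 by omega, show j < S.card + 2 by omega, dif_pos]
    exact e.strictMono hij
  · intro g
    have hg : g ∈ S ↔ t g ∈ T := by
      have := htlt g
      simp only [hT, Finset.mem_insert, htinj.mem_finset_image]
      constructor
      · exact fun h => .inr (.inr h)
      · rintro (h | h | h)
        · omega
        · omega
        · exact h
    rw [hg, hmem]
    constructor
    · rintro ⟨i, hi⟩
      have h3 := htlt g
      refine ⟨i, ?_, ?_, ?_⟩
      · by_contra hc
        have : i = ⟨0, by omega⟩ := Fin.ext (show (i : ℕ) = 0 by omega)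
        rw [this, e0] at hi
        omega
      · by_contra hc
        have : i = ⟨S.card + 1, by omega⟩ := Fin.ext (by simp; omega)
        rw [this, e1] at hi
        omega
      · simpa using hi
    · rintro ⟨j, hj1, hjk, hj⟩
      rw [dif_pos (by omega)] at hj
      exact ⟨_, hj⟩

/-- Each of `σ 1, …, σ k` lies strictly between the sentinels and is therefore a shifted code;
strict monotonicity makes the `k` tuples distinct. -/
theorem exists_finset_enumerates {n s k : ℕ} {σ : ℕ → ℕ} (zero : σ 0 = 0)
    (last : σ (k + 1) = n ^ s + 1) (lt : ∀ i j, i < j → j ≤ k + 1 → σ i < σ j) :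
    ∃ S : Finset (Fin s → Fin n), S.card = k ∧ Enumerates S k σ := by
  classical
  set S : Finset (Fin s → Fin n) := Finset.univ.filter fun g =>
    ∃ j, 1 ≤ j ∧ j ≤ k ∧ σ j = code n (fun i => (g i : ℕ)) + 1 with hS
  refine ⟨S, ?_, zero, last, lt, fun g => by simp [hS]⟩
  have himg : S.image (fun g => code n (fun i => (g i : ℕ)) + 1) = (Finset.Icc 1 k).image σ := by
    ext x
    simp only [Finset.mem_image, Finset.mem_Icc, hS, Finset.mem_filter, Finset.mem_univ, true_and]
    constructor
    · rintro ⟨g, ⟨j, h1, h2, h3⟩, rfl⟩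
      exact ⟨j, ⟨h1, h2⟩, h3⟩
    · rintro ⟨j, ⟨h1, h2⟩, rfl⟩
      have h3 := lt 0 j (by omega) (by omega)
      have h4 := lt j (k + 1) (by omega) le_rfl
      obtain ⟨g, hg⟩ := exists_code_eq (n := n) (s := s) (t := σ j - 1) (by omega)
      exact ⟨g, ⟨j, h1, h2, by omega⟩, by omega⟩
  have h1 := congrArg Finset.card himg
  rw [Finset.card_image_of_injective _ fun g g' h => code_injective (Nat.succ_injective h),
    Finset.card_image_of_injOn, Nat.card_Icc] at h1
  · omega
  · intro i hi j hj hij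
    simp only [Finset.coe_Icc, Set.mem_Icc] at hi hj
    rcases lt_trichotomy i j with h | h | h
    · have := lt i j h (by omega)
      omega
    · exact h
    · have := lt j i h (by omega)
      omega

/-! ### Weighted definability as a multicoloured hitting set problem -/

/-- `J` and `J'` code tuples of indices and `u` and `u'` tuples of values; they are part of a
strictly increasing function mapping `0` to `0` and `k + 1` to `N + 1`. -/
def Consistent (c k N J u J' u' : ℕ) : Prop :=
  ∀ i i' : Fin c,
    (digit (k + 2) J i = digit (k + 2) J' i' → digit (N + 2) u i = digit (N + 2) u' i') ∧
    (digit (k + 2) J i < digit (k + 2) J' i' → digit (N + 2) u i < digit (N + 2) u' i') ∧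
    (digit (k + 2) J i = 0 → digit (N + 2) u i = 0) ∧
    (digit (k + 2) J i = k + 1 → digit (N + 2) u i = N + 1)

namespace Pi2Formula

variable (φ : Pi2Formula)

/-- The number of values of an enumeration of the relation variable that suffice to certify the
matrix of the formula; at least one. -/
def width : ℕ := 2 * φ.matrix.numX + 1

/-- The position of the truth table of `r` in the encoding of a structure of size `n`. -/
def offset (n : ℕ) (r : Fin φ.m) : ℕ :=
  n + 1 + ∑ r' : Fin φ.m, if r' < r then n ^ φ.ar r' else 0

/-- The values coded by `u` of the enumeration at the indices coded by `J` certify the formula for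
the assignment coded by `a` of the universally quantified variables. -/
def Certifies (inp : ℕ → ℕ) (n k a J u : ℕ) : Prop :=
  ∃ b < n ^ φ.q, φ.matrix.Cert inp (φ.offset n) n (fun i : Fin φ.width => digit (k + 2) J i)
    (fun i : Fin φ.width => digit (n ^ φ.s + 2) u i)
    (Sum.elim (fun i : Fin φ.p => digit n a i) fun i : Fin φ.q => digit n b i) true

/-- `f` chooses an element of each class such that all sets are hit. -/
structure IsSelection (inp : ℕ → ℕ) (n k : ℕ) (f : ℕ → ℕ) : Prop where
  lt : ∀ J < (k + 2) ^ φ.width, f J < (n ^ φ.s + 2) ^ φ.width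
  consistent : ∀ J < (k + 2) ^ φ.width, ∀ J' < (k + 2) ^ φ.width,
    Consistent φ.width k (n ^ φ.s) J (f J) J' (f J')
  certifies : ∀ a < n ^ φ.p, ∃ J < (k + 2) ^ φ.width, φ.Certifies inp n k a J (f J)

variable {φ} {A : FinStruct φ.ar} {inp : ℕ → ℕ} {k : ℕ}

/-- Consistency glues the local choices into one function: `σ j` is read off the class of the
constant index tuple `(j, …, j)`, and every other class must agree with it wherever the index `j`
occurs. -/
theorem exists_finset_of_isSelection
    (hinp : ∀ r (g : Fin (φ.ar r) → Fin A.size),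
      inp (φ.offset A.size r + code A.size fun i => (g i : ℕ)) = 2 ↔ A.rel r g = true)
    {f : ℕ → ℕ} (hf : φ.IsSelection inp A.size k f) :
    ∃ S : Finset (Fin φ.s → Fin A.size), S.card = k ∧ φ.Holds A S := by
  have hconst : ∀ j, ∃ J, j < k + 2 → J < (k + 2) ^ φ.width ∧
      ∀ i : Fin φ.width, digit (k + 2) J i = j := by
    intro j
    by_cases hj : j < k + 2
    · obtain ⟨J, h⟩ := exists_digit_eq (fun _ : Fin φ.width => j) fun _ => hj
      exact ⟨J, fun _ => h⟩
    · exact ⟨0, fun h => absurd h hj⟩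
  choose C hC using hconst
  -- A digit position exists because the width is at least one, even if `X` does not occur.
  let i₀ : Fin φ.width := ⟨0, by simp [width]⟩
  set σ : ℕ → ℕ := fun j => digit (A.size ^ φ.s + 2) (f (C j)) i₀ with hσ
  have hval : ∀ J < (k + 2) ^ φ.width, ∀ i : Fin φ.width,
      digit (A.size ^ φ.s + 2) (f J) i = σ (digit (k + 2) J i) := by
    intro J hJ i
    have hd : digit (k + 2) J i < k + 2 := digit_lt (by omega) _ _
    exact (hf.consistent J hJ _ (hC _ hd).1 i i₀).1 ((hC _ hd).2 i₀).symm
  obtain ⟨S, hcard, hS⟩ := exists_finset_enumerates (n := A.size) (s := φ.s) (k := k) (σ := σ)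
    (by
      obtain ⟨h1, h2⟩ := hC 0 (by omega)
      exact (hf.consistent _ h1 _ h1 i₀ i₀).2.2.1 (h2 i₀))
    (by
      obtain ⟨h1, h2⟩ := hC (k + 1) (by omega)
      exact (hf.consistent _ h1 _ h1 i₀ i₀).2.2.2 (h2 i₀))
    (by
      intro i j hij hj
      obtain ⟨h1, h2⟩ := hC i (by omega)
      obtain ⟨h3, h4⟩ := hC j (by omega)
      exact (hf.consistent _ h1 _ h3 i₀ i₀).2.1 (by rw [h2, h4]; exact hij))
  refine ⟨S, hcard, fun a => ?_⟩
  obtain ⟨a', ha', haa⟩ := exists_digit_eq (fun i => (a i : ℕ)) fun i => (a i).2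
  obtain ⟨J, hJ, b, -, hb⟩ := hf.certifies a' ha'
  refine ⟨fun i => ⟨digit A.size b i, digit_lt A.size_pos _ _⟩, ?_⟩
  refine (QFFormula.Cert.sound hS hinp (J := fun i : Fin φ.width => digit (k + 2) J i)
    (fun i => Nat.lt_succ_iff.1 (digit_lt (by omega) _ _)) _ _ true ?_).2 rfl
  convert hb using 1
  · exact funext fun i => (hval J hJ i).symm
  · funext v
    rcases v with v | v
    · simp [haa]
    · simp

/-- For an enumeration `σ` of `S`, class `J` selects the tuple of the values of `σ` at the digits of
`J`. -/
theorem exists_isSelection_of_holds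
    (hinp : ∀ r (g : Fin (φ.ar r) → Fin A.size),
      inp (φ.offset A.size r + code A.size fun i => (g i : ℕ)) = 2 ↔ A.rel r g = true)
    {S : Finset (Fin φ.s → Fin A.size)} (hS : S.card = k) (hφ : φ.Holds A S) :
    ∃ f, φ.IsSelection inp A.size k f := by
  obtain ⟨σ, hσ⟩ := exists_enumerates S
  rw [hS] at hσ
  have hσlt : ∀ j ≤ k + 1, σ j < A.size ^ φ.s + 2 := by
    intro j hj
    rcases hj.eq_or_lt with rfl | h
    · rw [hσ.last]; omega
    · have := hσ.lt j (k + 1) h le_rfl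
      rw [hσ.last] at this
      omega
  have hdle : ∀ J i, digit (k + 2) J i ≤ k + 1 := fun J i =>
    Nat.lt_succ_iff.1 (digit_lt (by omega) _ _)
  choose f hf hfd using fun J => exists_digit_eq (c := φ.width)
    (fun i => σ (digit (k + 2) J i)) fun i => hσlt _ (hdle J i)
  refine ⟨f, fun J _ => hf J, fun J _ J' _ i i' => ?_, fun a _ => ?_⟩
  · rw [hfd, hfd]
    exact ⟨fun h => by rw [h], fun h => hσ.lt _ _ h (hdle _ _), fun h => by rw [h, hσ.zero],
      fun h => by rw [h, hσ.last]⟩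
  · obtain ⟨b, hb⟩ := hφ fun i => ⟨digit A.size a i, digit_lt A.size_pos _ _⟩
    obtain ⟨l, hl, hlk, hc⟩ := QFFormula.Cert.complete hσ hinp (Sum.elim
      (fun i : Fin φ.p => (⟨digit A.size a i, digit_lt A.size_pos _ _⟩ : Fin A.size)) b) φ.matrix
    -- The list of required indices is padded to the full width by the index `0`, which is always
    -- legitimate.
    obtain ⟨J, hJ, hJd⟩ := exists_digit_eq (b := k + 2)
      (fun i : Fin φ.width => l.getD i 0) fun i => by
        rw [List.getD_eq_getElem?_getD]
        cases h : l[(i : ℕ)]? with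
        | none => simp
        | some v =>
          have := hlk v (List.mem_of_getElem? h)
          simp; omega
    obtain ⟨b', hb', hbb⟩ := exists_digit_eq (fun i => (b i : ℕ)) fun i => (b i).2
    refine ⟨J, hJ, b', hb', ?_⟩
    have key := hc (fun i : Fin φ.width => digit (k + 2) J i) fun j hj => by
      obtain ⟨i, hi, rfl⟩ := List.getElem_of_mem hj
      exact ⟨⟨i, by simp only [width]; omega⟩, by rw [hJd]; simp [hi]⟩
    simp only [hb, decide_true] at key
    convert key using 1
    · exact funext fun i => hfd J i
    · funext v
      rcases v with v | v
      · simp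
      · simp [hbb]

end Pi2Formula

/-! ### Encodings -/

theorem cells_eq_zero {x : List Bool} {i : ℕ} : cells x i = 0 ↔ x.length ≤ i := by
  unfold cells
  rw [← List.getElem?_eq_none_iff]
  rcases x[i]? with _ | _ | _ <;> simp

theorem cells_le_two (x : List Bool) (i : ℕ) : cells x i ≤ 2 := by
  unfold cells
  rcases x[i]? with _ | _ | _ <;> simp

theorem cells_unary_lt {n i : ℕ} (l : List Bool) (hi : i < n) :
    cells (List.replicate n true ++ false :: l) i = 2 := by
  simp [cells, List.getElem?_append, hi]

theorem cells_unary_self (n : ℕ) (l : List Bool) :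
    cells (List.replicate n true ++ false :: l) n = 1 := by
  simp [cells]

theorem cells_unary_add (n i : ℕ) (l : List Bool) :
    cells (List.replicate n true ++ false :: l) (n + 1 + i) = cells l i := by
  have : n + 1 + i - n = i + 1 := by omega
  simp [cells, List.getElem?_append, show ¬ n + 1 + i < n by omega, this]

theorem unary_injective {n n' : ℕ} {l l' : List Bool}
    (h : List.replicate n true ++ false :: l = List.replicate n' true ++ false :: l') :
    n = n' := by
  rcases lt_trichotomy n n' with hn | hn | hn
  · have h1 := cells_unary_self n l
    rw [h, cells_unary_lt _ hn] at h1
    omega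
  · exact hn
  · have h1 := cells_unary_self n' l'
    rw [← h, cells_unary_lt _ hn] at h1
    omega

/-- Block `r` starts after the total length of the earlier blocks; this is where `Pi2Formula.offset`
comes from. -/
theorem getElem?_flatMap_ofFn {m : ℕ} (len : Fin m → ℕ) (F : (r : Fin m) → Fin (len r) → Bool)
    (r : Fin m) (j : Fin (len r)) :
    ((List.finRange m).flatMap fun r => List.ofFn (F r))[(∑ r', if r' < r then len r' else 0) + j]?
      = some (F r j) := by
  induction m with
  | zero => exact r.elim0
  | succ m ih =>
    rw [List.finRange_succ, List.flatMap_cons, List.flatMap_map, List.getElem?_append]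
    refine Fin.cases (fun j => ?_) (fun r j => ?_) r j
    · simp
    · have hs : (∑ r', if r' < r.succ then len r' else 0)
          = len 0 + ∑ r' : Fin m, if r' < r then len r'.succ else 0 := by
        simp [Fin.sum_univ_succ]
      rw [hs, if_neg (by simp; omega), List.length_ofFn,
        show len 0 + (∑ r' : Fin m, if r' < r then len r'.succ else 0) + j - len 0
          = (∑ r' : Fin m, if r' < r then len r'.succ else 0) + j by omega]
      exact ih (fun r => len r.succ) (fun r => F r.succ) r j

theorem length_flatMap_ofFn {m : ℕ} (len : Fin m → ℕ) (F : (r : Fin m) → Fin (len r) → Bool) :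
    ((List.finRange m).flatMap fun r => List.ofFn (F r)).length = ∑ r, len r := by
  simp [List.length_flatMap, Fin.sum_univ_def]

theorem FinStruct.length_encode {m : ℕ} {ar : Fin m → ℕ} (A : FinStruct ar) :
    A.encode.length = A.size + 1 + ∑ r, A.size ^ ar r := by
  rw [encode, List.length_append, List.length_cons, length_flatMap_ofFn, List.length_replicate]
  omega

theorem Pi2Formula.cells_encode {φ : Pi2Formula} (A : FinStruct φ.ar) (r : Fin φ.m)
    (g : Fin (φ.ar r) → Fin A.size) :
    cells A.encode (φ.offset A.size r + code A.size fun i => (g i : ℕ)) = 2 ↔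
      A.rel r g = true := by
  rw [FinStruct.encode, offset, Nat.add_assoc, cells_unary_add, code_val, cells,
    getElem?_flatMap_ofFn, Equiv.symm_apply_apply]
  cases A.rel r g <;> simp

open Classical in
-- The rows form one table whose entry `x` has row `x / n` and column `x % n`. Adjacency is phrased
-- for natural numbers, the form in which the machine evaluates it.
theorem encodeGraph_eq {n : ℕ} (G : SimpleGraph (Fin n)) (adj : ℕ → ℕ → Prop)
    (hG : ∀ i j, G.Adj i j ↔ adj i j) :
    encodeGraph G = List.replicate n true ++ false ::
      List.ofFn fun x : Fin (n * n) => decide (adj (x / n) (x % n)) := by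
  have hrow : ∀ i j : Fin n, decide (G.Adj i j)
      = decide (adj (((i : ℕ) * n + j) / n) (((i : ℕ) * n + j) % n)) := fun i j => by
    rw [Nat.mul_comm, Nat.mul_add_div i.pos, Nat.div_eq_of_lt j.2, Nat.add_zero, Nat.mul_add_mod,
      Nat.mod_eq_of_lt j.2]
    simp only [hG]
  rw [encodeGraph, List.ofFn_mul, List.ofFn_eq_map, ← List.flatMap_def]
  simp only [List.ofFn_eq_map, hrow]

open Classical in
theorem cells_encodeGraph {n : ℕ} (G : SimpleGraph (Fin n)) (adj : ℕ → ℕ → Prop)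
    (hG : ∀ i j, G.Adj i j ↔ adj i j) (j : ℕ) :
    cells (encodeGraph G) j = if j < n then 2 else if j = n then 1 else
      if j < n + 1 + n * n then
        (if adj ((j - (n + 1)) / n) ((j - (n + 1)) % n) then 2 else 1) else 0 := by
  rw [encodeGraph_eq G adj hG]
  split_ifs with h1 h2 h3 h4
  · exact cells_unary_lt _ h1
  · rw [h2, cells_unary_self]
  all_goals
    obtain ⟨i, rfl⟩ : ∃ i, j = n + 1 + i := ⟨j - (n + 1), by omega⟩
    rw [cells_unary_add]
  · rw [Nat.add_sub_cancel_left] at h4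
    simp [cells, show i < n * n by omega, h4]
  · rw [Nat.add_sub_cancel_left] at h4
    simp [cells, show i < n * n by omega, h4]
  · rw [cells_eq_zero]
    simp; omega

theorem length_encodeGraph {n : ℕ} (G : SimpleGraph (Fin n)) :
    (encodeGraph G).length = n + 1 + n * n := by
  simp [encodeGraph, List.length_flatMap]
  ring

/-- A yes-instance asserts a solution in some graph with the given encoding; injectivity identifies
it with the constructed graph. -/
theorem encodeGraph_injective {n n' : ℕ} {G : SimpleGraph (Fin n)} {G' : SimpleGraph (Fin n')}
    (h : encodeGraph G = encodeGraph G') : ∃ e : n = n', e ▸ G = G' := by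
  classical
  obtain rfl : n = n' := unary_injective h
  refine ⟨rfl, ?_⟩
  have key : ∀ (H : SimpleGraph (Fin n)) (i j : Fin n),
      cells (encodeGraph H) (n + 1 + (i * n + j)) = if H.Adj i j then 2 else 1 := by
    intro H i j
    rw [cells_encodeGraph H (fun a b => ∃ (ha : a < n) (hb : b < n), H.Adj ⟨a, ha⟩ ⟨b, hb⟩)
      (by simp)]
    have hn : 0 < n := i.pos
    have h1 : (i : ℕ) * n + j < n * n := by
      calc (i : ℕ) * n + j < i * n + n := by omega
        _ = (i + 1) * n := by ring
        _ ≤ n * n := Nat.mul_le_mul_right _ i.2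
    rw [if_neg (by omega), if_neg (by omega), if_pos (by omega), Nat.add_sub_cancel_left]
    have h2 : ((i : ℕ) * n + j) / n = i := by
      rw [Nat.mul_comm, Nat.mul_add_div hn, Nat.div_eq_of_lt j.2, Nat.add_zero]
    have h3 : ((i : ℕ) * n + j) % n = j := by
      rw [Nat.mul_comm, Nat.mul_add_mod, Nat.mod_eq_of_lt j.2]
    simp [h2, h3]
  ext i j
  have h1 := key G i j
  rw [h, key G' i j] at h1
  by_cases ha : G.Adj i j <;> by_cases hb : G'.Adj i j <;> simp_all

/-! ### The graph of a weighted definability instance -/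

namespace Pi2Formula

variable (φ : Pi2Formula)

/-- The number of classes of elements. -/
def numClasses (k : ℕ) : ℕ := (k + 2) ^ φ.width

/-- The number of elements of each class. -/
def numChoices (n : ℕ) : ℕ := (n ^ φ.s + 2) ^ φ.width

/-- The number of vertices. -/
def numVertices (n k : ℕ) : ℕ :=
  4 * (φ.numClasses k * (φ.numChoices n * (φ.numClasses k * n ^ φ.p)))

/-- The class of a vertex. -/
def cls (k v : ℕ) : ℕ := v / 4 % φ.numClasses k

/-- The element of its class that a vertex stands for or is about. -/
def choice (n k v : ℕ) : ℕ := v / 4 / φ.numClasses k % φ.numChoices n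

/-- The second class that a consistency vertex is about. -/
def cls' (n k v : ℕ) : ℕ := v / 4 / φ.numClasses k / φ.numChoices n % φ.numClasses k

/-- The assignment of the universally quantified variables that a vertex is about. -/
def assignment (n k v : ℕ) : ℕ :=
  v / 4 / φ.numClasses k / φ.numChoices n / φ.numClasses k % n ^ φ.p

/-- The element `x` belongs to the set `y`. -/
def Hits (inp : ℕ → ℕ) (n k x y : ℕ) : Prop :=
  (y % 4 = 2 ∧ ((φ.cls k x = φ.cls k y ∧ ¬ φ.choice n k x = φ.choice n k y) ∨
    (φ.cls k x = φ.cls' n k y ∧ Consistent φ.width k (n ^ φ.s) (φ.cls k y) (φ.choice n k y)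
      (φ.cls k x) (φ.choice n k x)))) ∨
  (y % 4 = 3 ∧ φ.Certifies inp n k (φ.assignment n k y) (φ.cls k x) (φ.choice n k x))

/-- The graph of the weighted definability instance. -/
def graph (inp : ℕ → ℕ) (n k : ℕ) : SimpleGraph (Fin (φ.numVertices n k)) :=
  gadget (fun v => v % 4) (fun v => φ.cls k v) fun x y => φ.Hits inp n k x y

theorem numClasses_pos (k : ℕ) : 0 < φ.numClasses k := Nat.pow_pos (by omega)

theorem numChoices_pos (n : ℕ) : 0 < φ.numChoices n := Nat.pow_pos (by omega)

variable {φ} {inp : ℕ → ℕ} {n k : ℕ}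

/-- A vertex is a mixed-radix number whose digits are its tag and four data, so all combinations
occur. Digits irrelevant to a tag only produce duplicate vertices. -/
theorem exists_vertex {t J u J' a : ℕ} (ht : t < 4) (hJ : J < φ.numClasses k)
    (hu : u < φ.numChoices n) (hJ' : J' < φ.numClasses k) (ha : a < n ^ φ.p) :
    ∃ v : Fin (φ.numVertices n k), (v : ℕ) % 4 = t ∧ φ.cls k v = J ∧ φ.choice n k v = u ∧
      φ.cls' n k v = J' ∧ φ.assignment n k v = a := by
  have hlt : ∀ {b x c q : ℕ}, x < b → q < c → x + b * q < b * c := by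
    intro b x c q hx hq
    calc x + b * q < b + b * q := by omega
      _ = b * (q + 1) := by ring
      _ ≤ b * c := Nat.mul_le_mul_left _ hq
  have hm : ∀ {b x : ℕ} (q : ℕ), x < b → (x + b * q) % b = x := fun q hx => by
    rw [Nat.add_mul_mod_self_left, Nat.mod_eq_of_lt hx]
  have hd : ∀ {b x : ℕ} (q : ℕ), x < b → (x + b * q) / b = q := fun q hx => by
    rw [Nat.add_mul_div_left _ _ (by omega), Nat.div_eq_of_lt hx, Nat.zero_add]
  refine ⟨⟨t + 4 * (J + φ.numClasses k * (u + φ.numChoices n * (J' + φ.numClasses k * a))),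
    hlt ht (hlt hJ (hlt hu (hlt hJ' ha)))⟩, ?_⟩
  simp only [cls, choice, cls', assignment]
  rw [hd _ ht, hd _ hJ, hd _ hu, hd _ hJ']
  exact ⟨hm _ ht, hm _ hJ, hm _ hu, hm _ hJ', Nat.mod_eq_of_lt ha⟩

theorem exists_isSelection_of_dominating (hn : 0 < n) {D : Finset (Fin (φ.numVertices n k))}
    (hD : IsDominatingSet (φ.graph inp n k) D) (hcard : D.card ≤ φ.numClasses k) :
    ∃ f, φ.IsSelection inp n k f := by
  have hK := φ.numClasses_pos k
  have hR := φ.numChoices_pos n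
  have hP : 0 < n ^ φ.p := Nat.pow_pos hn
  obtain ⟨hinj, hhit⟩ := gadget_elements_of_dominating (K := φ.numClasses k) (fun J hJ => by
    obtain ⟨v, h1, h2, -⟩ := exists_vertex (t := 1) (by omega) hJ hR hK hP
    exact ⟨v, h1, h2⟩) hD hcard
  have hex : ∀ J, ∃ x, J < φ.numClasses k → x ∈ D ∧ φ.cls k x = J := by
    intro J
    by_cases hJ : J < φ.numClasses k
    · obtain ⟨v, h1, h2, h3, h4, -⟩ := exists_vertex (t := 2) (by omega) hJ hR hJ hP
      obtain ⟨x, hx, -, hxv⟩ := hhit v (by omega)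
      refine ⟨x, fun _ => ⟨hx, ?_⟩⟩
      simp only [Hits, h1, h2, h4] at hxv
      rcases hxv with ⟨-, h | h⟩ | h
      · exact h.1
      · exact h.1
      · exact absurd h.1 (by norm_num)
    · obtain ⟨v, -⟩ := exists_vertex (t := 2) (by omega) hK hR hK hP
      exact ⟨v, fun h => absurd h hJ⟩
  choose e he using hex
  have huniq : ∀ x ∈ D, e (φ.cls k x) = x := fun x hx => by
    obtain ⟨h1, h2⟩ := he (φ.cls k x) (Nat.mod_lt _ hK)
    exact hinj h1 hx h2
  refine ⟨fun J => φ.choice n k (e J), fun J _ => Nat.mod_lt _ hR, fun J hJ J' hJ' => ?_,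
    fun a ha => ?_⟩
  -- The set about the selected element of `J` and the class `J'`: no other element of class `J`
  -- lies in `D`, so it is hit by the selected element of `J'`, which is thus consistent.
  · obtain ⟨v, h1, h2, h3, h4, -⟩ := exists_vertex (t := 2) (by omega) hJ
      (Nat.mod_lt _ hR : φ.choice n k (e J) < _) hJ' hP
    obtain ⟨x, hx, -, hxv⟩ := hhit v (by omega)
    simp only [Hits, h1, h2, h3, h4] at hxv
    have hxe := huniq x hx
    rcases hxv with ⟨-, ⟨h, h'⟩ | ⟨h, h'⟩⟩ | h
    · rw [h] at hxe
      exact absurd (by rw [hxe]; rfl) h'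
    · rw [h] at hxe h'
      rwa [hxe]
    · exact absurd h.1 (by norm_num)
  · obtain ⟨v, h1, -, -, -, h5⟩ := exists_vertex (t := 3) (by omega) hK hR hK ha
    obtain ⟨x, hx, -, hxv⟩ := hhit v (by omega)
    simp only [Hits, h1, h5] at hxv
    rcases hxv with h | h
    · exact absurd h.1 (by norm_num)
    · exact ⟨φ.cls k x, Nat.mod_lt _ hK, by rw [huniq x hx]; exact h.2⟩

theorem IsSelection.exists_dominating (hn : 0 < n) {f : ℕ → ℕ} (hf : φ.IsSelection inp n k f) :
    ∃ D : Finset (Fin (φ.numVertices n k)), D.card ≤ φ.numClasses k ∧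
      IsDominatingSet (φ.graph inp n k) D ∧ (φ.graph inp n k).IsClique (D : Set _) ∧
      D.Nonempty := by
  have hK := φ.numClasses_pos k
  have hP : 0 < n ^ φ.p := Nat.pow_pos hn
  choose e he using fun J : Fin (φ.numClasses k) =>
    exists_vertex (t := 0) (by omega) J.2 (hf.lt J J.2) hK hP
  refine gadget_dominating_of_elements hK (fun x => Nat.mod_lt _ hK) e
    (fun J => ⟨(he J).1, (he J).2.1⟩) fun y hy => ?_
  have h4 : (y : ℕ) % 4 < 4 := Nat.mod_lt _ (by norm_num)
  rcases (show (y : ℕ) % 4 = 2 ∨ (y : ℕ) % 4 = 3 by omega) with h | h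
  -- If the consistency vertex is about the selected element, its second class hits it by
  -- consistency; otherwise its first class hits it by having made a different choice.
  · by_cases hc : f (φ.cls k y) = φ.choice n k y
    · obtain ⟨-, h2, h3, -⟩ := he ⟨φ.cls' n k y, Nat.mod_lt _ hK⟩
      refine ⟨⟨φ.cls' n k y, Nat.mod_lt _ hK⟩, .inl ⟨h, .inr ⟨h2, ?_⟩⟩⟩
      rw [h2, h3, ← hc]
      exact hf.consistent _ (Nat.mod_lt _ hK) _ (Nat.mod_lt _ hK)
    · obtain ⟨-, h2, h3, -⟩ := he ⟨φ.cls k y, Nat.mod_lt _ hK⟩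
      exact ⟨⟨φ.cls k y, Nat.mod_lt _ hK⟩, .inl ⟨h, .inl ⟨h2, by rw [h3]; exact hc⟩⟩⟩
  · obtain ⟨J, hJ, hcert⟩ := hf.certifies (φ.assignment n k y) (Nat.mod_lt _ hP)
    obtain ⟨-, h2, h3, -⟩ := he ⟨J, hJ⟩
    exact ⟨⟨J, hJ⟩, .inr ⟨h, by rw [h2, h3]; exact hcert⟩⟩

end Pi2Formula

/-! ### The graph is computable in polynomial time -/

theorem PolyComp.digit {b x : Mem → ℕ} (hb : PolyComp b) (hx : PolyComp x) (i : ℕ) :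
    PolyComp fun m => digit (b m) (x m) i :=
  (hx.div (hb.pow i)).mod hb

theorem PolyComp.code {s : ℕ} {b : Mem → ℕ} {g : Fin s → Mem → ℕ} (hb : PolyComp b)
    (hg : ∀ i, PolyComp (g i)) : PolyComp fun m => code (b m) fun i => g i m :=
  PolyComp.sum_fin fun i => (hg i).mul (hb.pow i)

/-- The formula is fixed, so recursion on it builds the program and does not happen at run time. -/
theorem QFFormula.polyDec_cert {m : ℕ} {ar : Fin m → ℕ} {s : ℕ} {V : Type}
    {off : Fin m → Mem → ℕ} {n : Mem → ℕ} {c : ℕ} {J u : Fin c → Mem → ℕ} {val : V → Mem → ℕ}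
    (hoff : ∀ r, PolyComp (off r)) (hn : PolyComp n) (hJ : ∀ i, PolyComp (J i))
    (hu : ∀ i, PolyComp (u i)) (hval : ∀ v, PolyComp (val v)) (ψ : QFFormula ar s V) (b : Bool) :
    PolyDec fun M => ψ.Cert (M.arr 0) (fun r => off r M) (n M) (fun i => J i M) (fun i => u i M)
      (fun v => val v M) b := by
  induction ψ generalizing b with
  | eq v w =>
    cases b
    · exact (PolyDec.eq (hval v) (hval w)).not
    · exact PolyDec.eq (hval v) (hval w)
  | rel r args =>
    have := PolyDec.eq ((hoff r).add (PolyComp.code hn fun i => hval (args i))).cell (.const 2)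
    cases b
    · exact this.not
    · exact this
  | X args =>
    have h := (PolyComp.code hn fun i => hval (args i)).add (.const 1)
    cases b
    · exact PolyDec.exists_fin fun i => PolyDec.exists_fin fun i' =>
        (PolyDec.eq (hJ i') ((hJ i).add (.const 1))).and
          ((PolyDec.lt (hu i) h).and (PolyDec.lt h (hu i')))
    · exact PolyDec.exists_fin fun i => PolyDec.eq (hu i) h
  | not ψ ih => exact ih (!b)
  | and ψ χ ih₁ ih₂ =>
    cases b
    · exact (ih₁ false).or (ih₂ false)
    · exact (ih₁ true).and (ih₂ true)
  | or ψ χ ih₁ ih₂ =>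
    cases b
    · exact (ih₁ false).and (ih₂ false)
    · exact (ih₁ true).or (ih₂ true)

theorem PolyDec.consistent {c : ℕ} {k N J u J' u' : Mem → ℕ} (hk : PolyComp k) (hN : PolyComp N)
    (hJ : PolyComp J) (hu : PolyComp u) (hJ' : PolyComp J') (hu' : PolyComp u') :
    PolyDec fun m => Consistent c (k m) (N m) (J m) (u m) (J' m) (u' m) := by
  have hk2 := hk.add (.const 2)
  have hN2 := hN.add (.const 2)
  refine PolyDec.forall_fin fun i => PolyDec.forall_fin fun i' => ?_
  exact ((PolyDec.eq (hk2.digit hJ i) (hk2.digit hJ' i')).imp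
      (PolyDec.eq (hN2.digit hu i) (hN2.digit hu' i'))).and
    (((PolyDec.lt (hk2.digit hJ i) (hk2.digit hJ' i')).imp
      (PolyDec.lt (hN2.digit hu i) (hN2.digit hu' i'))).and
    (((PolyDec.eq (hk2.digit hJ i) (.const 0)).imp (PolyDec.eq (hN2.digit hu i) (.const 0))).and
    ((PolyDec.eq (hk2.digit hJ i) (hk.add (.const 1))).imp
      (PolyDec.eq (hN2.digit hu i) (hN.add (.const 1))))))

namespace Pi2Formula

variable (φ : Pi2Formula)

theorem polyComp_offset (r : Fin φ.m) : PolyComp fun m => φ.offset (m.reg 1) r :=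
  ((PolyComp.reg (x := 1) (by norm_num)).add (.const 1)).add (PolyComp.sum_fin fun r' => by
    by_cases h : r' < r
    · simpa [h] using (PolyComp.reg (x := 1) (by norm_num)).pow (φ.ar r')
    · simpa [h] using PolyComp.const 0)

/-- Register `3` runs through the codes of the existential witnesses, so the other arguments must
not depend on it. -/
theorem polyDec_certifies {a J u : Mem → ℕ} (ha : PolyComp a) (hJ : PolyComp J) (hu : PolyComp u)
    (ha' : ∀ m b, a (m.setReg 3 b) = a m) (hJ' : ∀ m b, J (m.setReg 3 b) = J m)
    (hu' : ∀ m b, u (m.setReg 3 b) = u m) :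
    PolyDec fun m => φ.Certifies (m.arr 0) (m.reg 1) (m.reg 0) (a m) (J m) (u m) := by
  have hk : PolyComp fun m => m.reg 0 := PolyComp.reg (by norm_num)
  have hn : PolyComp fun m => m.reg 1 := PolyComp.reg (by norm_num)
  have h := (φ.matrix.polyDec_cert φ.polyComp_offset hn
    (fun i : Fin φ.width => (hk.add (.const 2)).digit hJ i)
    (fun i : Fin φ.width => ((hn.pow φ.s).add (.const 2)).digit hu i)
    (val := Sum.elim (fun (i : Fin φ.p) m => digit (m.reg 1) (a m) i)
      fun (i : Fin φ.q) m => digit (m.reg 1) (m.reg 3) i)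
    (by
      rintro (i | i)
      · exact hn.digit ha i
      · exact hn.digit (PolyComp.reg (by norm_num)) i) true).exists_lt (hn.pow φ.q) (x := 3)
        (by norm_num)
  refine h.congr fun m => ?_
  simp only [Certifies, Mem.setReg_reg, Mem.setReg_arr, hJ', hu']
  refine exists_congr fun b => and_congr_right fun _ => ?_
  apply iff_of_eq
  congr 1
  funext v
  rcases v with v | v <;> simp [ha']

theorem polyComp_numClasses : PolyComp fun m => φ.numClasses (m.reg 0) :=
  ((PolyComp.reg (by norm_num)).add (.const 2)).pow _

theorem polyComp_numChoices : PolyComp fun m => φ.numChoices (m.reg 1) :=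
  (((PolyComp.reg (by norm_num)).pow _).add (.const 2)).pow _

theorem polyComp_numVertices : PolyComp fun m => φ.numVertices (m.reg 1) (m.reg 0) :=
  (PolyComp.const 4).mul (φ.polyComp_numClasses.mul (φ.polyComp_numChoices.mul
    (φ.polyComp_numClasses.mul ((PolyComp.reg (by norm_num)).pow _))))

variable {φ} {x y : Mem → ℕ}

theorem polyComp_cls (hx : PolyComp x) : PolyComp fun m => φ.cls (m.reg 0) (x m) :=
  (hx.div (.const 4)).mod φ.polyComp_numClasses

theorem polyComp_choice (hx : PolyComp x) :
    PolyComp fun m => φ.choice (m.reg 1) (m.reg 0) (x m) :=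
  ((hx.div (.const 4)).div φ.polyComp_numClasses).mod φ.polyComp_numChoices

theorem polyComp_cls' (hx : PolyComp x) : PolyComp fun m => φ.cls' (m.reg 1) (m.reg 0) (x m) :=
  (((hx.div (.const 4)).div φ.polyComp_numClasses).div φ.polyComp_numChoices).mod
    φ.polyComp_numClasses

theorem polyComp_assignment (hx : PolyComp x) :
    PolyComp fun m => φ.assignment (m.reg 1) (m.reg 0) (x m) :=
  ((((hx.div (.const 4)).div φ.polyComp_numClasses).div φ.polyComp_numChoices).div
    φ.polyComp_numClasses).mod ((PolyComp.reg (by norm_num)).pow _)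

theorem polyDec_hits (hx : PolyComp x) (hy : PolyComp y) (hx' : ∀ m b, x (m.setReg 3 b) = x m)
    (hy' : ∀ m b, y (m.setReg 3 b) = y m) :
    PolyDec fun m => φ.Hits (m.arr 0) (m.reg 1) (m.reg 0) (x m) (y m) := by
  have hk : PolyComp fun m => m.reg 0 := PolyComp.reg (by norm_num)
  have hn : PolyComp fun m => m.reg 1 := PolyComp.reg (by norm_num)
  have hy4 := hy.mod (.const 4)
  refine ((PolyDec.eq hy4 (.const 2)).and
    (((PolyDec.eq (polyComp_cls hx) (polyComp_cls hy)).and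
      (PolyDec.eq (polyComp_choice hx) (polyComp_choice hy)).not).or
    ((PolyDec.eq (polyComp_cls hx) (polyComp_cls' hy)).and
      (PolyDec.consistent hk (hn.pow φ.s) (polyComp_cls hy) (polyComp_choice hy) (polyComp_cls hx)
        (polyComp_choice hx))))).or
    ((PolyDec.eq hy4 (.const 3)).and (φ.polyDec_certifies (polyComp_assignment hy)
      (polyComp_cls hx) (polyComp_choice hx) ?_ ?_ ?_)) <;>
  · intro m b
    simp [hx', hy']

/-- Adjacency in the graph, for numbers as vertices. -/
def Adj (φ : Pi2Formula) (inp : ℕ → ℕ) (n k x y : ℕ) : Prop :=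
  x ≠ y ∧ (GadgetRel (fun v : ℕ => v % 4) (φ.cls k) (φ.Hits inp n k) x y ∨
    GadgetRel (fun v : ℕ => v % 4) (φ.cls k) (φ.Hits inp n k) y x)

theorem polyDec_gadgetRel (hx : PolyComp x) (hy : PolyComp y)
    (hx' : ∀ m b, x (m.setReg 3 b) = x m) (hy' : ∀ m b, y (m.setReg 3 b) = y m) :
    PolyDec fun m => GadgetRel (fun v : ℕ => v % 4) (φ.cls (m.reg 0))
      (φ.Hits (m.arr 0) (m.reg 1) (m.reg 0)) (x m) (y m) := by
  have hx4 := hx.mod (.const 4)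
  have hy4 := hy.mod (.const 4)
  exact ((PolyDec.eq hx4 (.const 0)).and (PolyDec.eq hy4 (.const 0))).or
    (((PolyDec.le (.const 2) hx4).and (PolyDec.le (.const 2) hy4)).or
    (((PolyDec.le hx4 (.const 1)).and ((PolyDec.le hy4 (.const 1)).and
      (PolyDec.eq (polyComp_cls hx) (polyComp_cls hy)))).or
    ((PolyDec.eq hx4 (.const 0)).and ((PolyDec.le (.const 2) hy4).and
      (polyDec_hits hx hy hx' hy')))))

theorem polyDec_adj (hx : PolyComp x) (hy : PolyComp y) (hx' : ∀ m b, x (m.setReg 3 b) = x m)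
    (hy' : ∀ m b, y (m.setReg 3 b) = y m) :
    PolyDec fun m => φ.Adj (m.arr 0) (m.reg 1) (m.reg 0) (x m) (y m) :=
  (PolyDec.eq hx hy).not.and ((polyDec_gadgetRel hx hy hx' hy').or
    (polyDec_gadgetRel hy hx hy' hx'))

variable (φ)

open Classical in
/-- The cell at position `j` of the encoding of the graph. -/
noncomputable def outCell (inp : ℕ → ℕ) (n k j : ℕ) : ℕ :=
  if j < φ.numVertices n k then 2 else if j = φ.numVertices n k then 1 else
    if j < φ.numVertices n k + 1 + φ.numVertices n k * φ.numVertices n k then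
      (if φ.Adj inp n k ((j - (φ.numVertices n k + 1)) / φ.numVertices n k)
        ((j - (φ.numVertices n k + 1)) % φ.numVertices n k) then 2 else 1) else 0

theorem cells_encodeGraph_graph (inp : ℕ → ℕ) (n k j : ℕ) :
    cells (encodeGraph (φ.graph inp n k)) j = φ.outCell inp n k j := by
  classical
  rw [cells_encodeGraph _ (φ.Adj inp n k), outCell]
  intro i j
  simp only [graph, gadget, Adj, GadgetRel, ne_eq, Fin.ext_iff]

/-- Register convention: `0` holds `k`, `1` the size of the structure, `2` the output position and
`3` the existential witness. -/
theorem polyComp_outCell :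
    PolyComp fun m => φ.outCell (m.arr 0) (m.reg 1) (m.reg 0) (m.reg 2) := by
  have hj : PolyComp fun m => m.reg 2 := PolyComp.reg (by norm_num)
  have hW := φ.polyComp_numVertices
  have hd := hj.sub (hW.add (.const 1))
  classical
  exact PolyDec.ite (PolyDec.lt hj hW) (.const 2) (PolyDec.ite (PolyDec.eq hj hW) (.const 1)
    (PolyDec.ite (PolyDec.lt hj ((hW.add (.const 1)).add (hW.mul hW)))
      (PolyDec.ite (polyDec_adj (φ := φ) (hd.div hW) (hd.mod hW) (fun m b => by simp)
        (fun m b => by simp)) (.const 2) (.const 1)) (.const 0)))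

/-- A bound on the lengths of the input and the output. -/
def cellBound (n k : ℕ) : ℕ :=
  φ.numVertices n k + 1 + φ.numVertices n k * φ.numVertices n k + (n + 1 + ∑ r, n ^ φ.ar r)

theorem polyComp_cellBound : PolyComp fun m => φ.cellBound (m.reg 1) (m.reg 0) := by
  have hn : PolyComp fun m => m.reg 1 := PolyComp.reg (by norm_num)
  have hW := φ.polyComp_numVertices
  exact ((hW.add (.const 1)).add (hW.mul hW)).add ((hn.add (.const 1)).add
    (PolyComp.sum_fin fun r => hn.pow _))

end Pi2Formula

/-! ### The program of the reduction -/

/-- Find the length of the initial block of cells `2` of array `0`. -/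
def findUnary : Prog :=
  .seq (.const 4 1) (.seq (.const 1 0) (.seq (.load 5 0 1) (.seq (.sub 5 5 4)
    (.while 5 (.seq (.add 1 1 4) (.seq (.load 5 0 1) (.sub 5 5 4)))))))

theorem runsTo_findUnary {m : Mem} {n : ℕ} {l : List Bool}
    (h : m.arr 0 = cells (List.replicate n true ++ false :: l)) :
    RunsTo findUnary m (4 * n + 5) fun m' =>
      m'.arr = m.arr ∧ m'.reg 0 = m.reg 0 ∧ m'.reg 1 = n := by
  -- Register `5` holds the current cell minus one: `1` within the unary block and `0` at the
  -- separator.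
  have key : ∀ j i (m' : Mem), i + j = n → m'.arr = m.arr → m'.reg 0 = m.reg 0 → m'.reg 1 = i →
      m'.reg 4 = 1 → m'.reg 5 = m.arr 0 i - 1 →
      RunsTo (.while 5 (.seq (.add 1 1 4) (.seq (.load 5 0 1) (.sub 5 5 4)))) m' (4 * j + 1)
        fun m' => m'.arr = m.arr ∧ m'.reg 0 = m.reg 0 ∧ m'.reg 1 = n := by
    intro j
    induction j with
    | zero =>
      intro i m' hi ha h0 h1 h4 h5
      obtain rfl : i = n := by omega
      rw [h, cells_unary_self] at h5
      exact ⟨m', 1, .while_done h5, le_rfl, ha, h0, h1⟩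
    | succ j ih =>
      intro i m' hi ha h0 h1 h4 h5
      have hne : m'.reg 5 ≠ 0 := by
        rw [h5, h, cells_unary_lt _ (by omega)]
        norm_num
      obtain ⟨m₁, T₁, r₁, t₁, e₁⟩ : RunsTo (.seq (.add 1 1 4) (.seq (.load 5 0 1) (.sub 5 5 4))) m'
          3 fun m₁ => m₁.arr = m.arr ∧ m₁.reg 0 = m.reg 0 ∧ m₁.reg 1 = i + 1 ∧ m₁.reg 4 = 1 ∧
            m₁.reg 5 = m.arr 0 (i + 1) - 1 :=
        RunsTo.add_seq (RunsTo.load_seq (RunsTo.sub ⟨ha, by simp [h0], by simp [h1, h4],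
          by simp [h4], by simp [h1, h4, ha]⟩))
      obtain ⟨e1, e2, e3, e4, e5⟩ := e₁
      obtain ⟨m₂, T₂, r₂, t₂, e₂⟩ := ih (i + 1) m₁ (by omega) e1 e2 e3 e4 e5
      exact ⟨m₂, T₁ + T₂ + 1, .while_step hne r₁ r₂, by omega, e₂⟩
  refine (RunsTo.const_seq (RunsTo.const_seq (RunsTo.load_seq (RunsTo.sub_seq
    (key n 0 _ (by omega) ?_ ?_ ?_ ?_ ?_))))).mono (by omega) fun _ h => h
  all_goals simp

/-- Fill array `1` with the values of a function of register `2`. -/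
theorem exists_runsTo_fill {out len : Mem → ℕ} (hout : PolyComp out) (hlen : PolyComp len) :
    ∃ p h, PolyBounded h ∧ ∀ m V, m.Le V → m.reg 2 = 0 → RunsTo p m (h V) fun m' =>
      m'.arr 0 = m.arr 0 ∧ m'.reg 0 = m.reg 0 ∧ m'.reg 1 = m.reg 1 ∧ m'.reg 3 = m.reg 3 ∧
        ∀ i < len m, m'.arr 1 i = out (m.setReg 2 i) := by
  obtain ⟨cl, bl, hbl, vl, pl⟩ := hlen
  obtain ⟨co, bo, hbo, vo, po⟩ := hout
  obtain ⟨p₁, hp₁⟩ := pl 4 le_rfl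
  obtain ⟨p₂, hp₂⟩ := po 6 (by norm_num)
  -- The results go to array `1` because array `0` is still needed to compute later cells.
  refine ⟨.seq p₁ (.seq (.const 5 1)
    (Prog.times 4 5 (.seq p₂ (.seq (.store 1 2 6) (.add 2 2 5))))),
    fun V => bl V + (1 + (bl V * (bo (V + bl V) + (1 + 1) + 2) + 1)),
    hbl.add ((PolyBounded.const 1).add ((hbl.mul (((hbo.comp (PolyBounded.id.add hbl)).add
      (.const _)).add (.const _))).add (.const _))), fun m V hm h2 => ?_⟩
  refine (hp₁ m V hm).seq ?_
  rintro m₁ ⟨r₁, a₁, e₁⟩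
  refine RunsTo.const_seq ?_
  refine (RunsTo.times (τ := bo (V + bl V) + (1 + 1)) (N := len m) (by norm_num)
    (fun i m' => m'.arr 0 = m.arr 0 ∧ (m'.reg 0 = m.reg 0 ∧ m'.reg 1 = m.reg 1 ∧
      m'.reg 3 = m.reg 3) ∧ m'.reg 2 = i ∧ ∀ j < i, m'.arr 1 j = out (m.setReg 2 j))
    (fun i m' v h => by simpa using h) ?_
    ⟨by simp [a₁], ⟨by simp [r₁], by simp [r₁], by simp [r₁]⟩, by simp [r₁, h2],
      fun j hj => absurd hj (by omega)⟩ (by simp) (by simp [e₁])).mono ?_ ?_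
  · rintro i m' hi ⟨h0, ⟨hr0, hr1, hr3⟩, hr2, hf⟩ h1
    have hreg : ∀ j < 4, m'.reg j = (m.setReg 2 i).reg j := by
      intro j hj
      interval_cases j <;> simp [hr0, hr1, hr2, hr3]
    have hle : (m.setReg 2 i).Le (V + bl V) := by
      refine ⟨fun j hj => ?_, fun j => (hm.2 j).trans (by omega)⟩
      have := hm.1 j hj
      have := vl m V hm
      simp only [Mem.setReg_reg]
      split_ifs <;> omega
    refine (hp₂ m' _ (hle.congr hreg h0)).seq ?_
    rintro m₂ ⟨r₂, a₂, e₂⟩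
    have he : m₂.reg 6 = out (m.setReg 2 i) := by rw [e₂, co _ _ hreg h0]
    refine (RunsTo.store (Q := fun m₃ => m₃ = m₂.setArr 1 (m₂.reg 2) (m₂.reg 6)) rfl).seq ?_
    rintro _ rfl
    refine RunsTo.add ⟨⟨?_, ⟨?_, ?_, ?_⟩, ?_, ?_⟩, ?_, ?_⟩
    · simp [a₂, h0]
    · simp [r₂, hr0]
    · simp [r₂, hr1]
    · simp [r₂, hr3]
    · simp [r₂, hr2, h1]
    · intro j hj
      simp only [Mem.setReg_arr, Mem.setArr_arr, r₂ 2 (by norm_num), hr2, he, a₂, if_true,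
        Function.update_apply]
      split_ifs with hji
      · rw [hji]
      · exact hf j (by omega)
    · simp [r₂, h1]
    · simp [r₂]
  · have := vl m V hm
    have : len m * (bo (V + bl V) + (1 + 1) + 2) ≤ bl V * (bo (V + bl V) + (1 + 1) + 2) :=
      Nat.mul_le_mul_right _ this
    omega
  · rintro m' ⟨⟨h0, ⟨hr0, hr1, hr3⟩, hr2, hf⟩, -⟩
    exact ⟨h0, hr0, hr1, hr3, hf⟩

/-- Copy a part of array `1` to array `0`, and set register `0`. -/
theorem exists_runsTo_copy {len par : Mem → ℕ} (hlen : PolyComp len) (hpar : PolyComp par) :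
    ∃ p h, PolyBounded h ∧ ∀ m V, m.Le V → m.reg 2 = 0 → RunsTo p m (h V) fun m' =>
      m'.reg 0 = par m ∧ ∀ i, m'.arr 0 i = if i < len m then m.arr 1 i else m.arr 0 i := by
  obtain ⟨cl, bl, hbl, vl, pl⟩ := hlen
  obtain ⟨cp, bp, hbp, vp, pp⟩ := hpar
  obtain ⟨p₁, hp₁⟩ := pl 4 le_rfl
  obtain ⟨p₂, hp₂⟩ := pp 6 (by norm_num)
  -- Both length and parameter are evaluated before array `0` and register `0` are overwritten.
  -- Register `4` is `0` after the loop.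
  refine ⟨.seq p₁ (.seq p₂ (.seq (.const 5 1) (.seq
    (Prog.times 4 5 (.seq (.load 7 1 2) (.seq (.store 0 2 7) (.add 2 2 5)))) (.add 0 6 4)))),
    fun V => bl V + (bp V + (1 + ((bl V * (3 + 2) + 1) + 1))),
    hbl.add (hbp.add ((PolyBounded.const 1).add (((hbl.mul (.const _)).add (.const _)).add
      (.const _)))), fun m V hm h2 => ?_⟩
  refine (hp₁ m V hm).seq ?_
  rintro m₁ ⟨r₁, a₁, e₁⟩
  refine (hp₂ m₁ V (hm.congr (fun i hi => r₁ i hi) (congrFun a₁ 0))).seq ?_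
  rintro m₂ ⟨r₂, a₂, e₂⟩
  rw [cp m₁ m (fun i hi => r₁ i hi) (congrFun a₁ 0)] at e₂
  refine RunsTo.const_seq (RunsTo.seq (τ := bl V * (3 + 2) + 1) ((RunsTo.times (τ := 3)
    (N := len m) (by norm_num)
    (fun i m' => m'.arr 1 = m.arr 1 ∧ m'.reg 2 = i ∧ m'.reg 6 = par m ∧
      ∀ j, m'.arr 0 j = if j < i then m.arr 1 j else m.arr 0 j)
    (fun i m' v h => by simpa using h) ?_
    ⟨by simp [a₂, a₁], by simp [r₂, r₁, h2], by simp [e₂], by simp [a₁, a₂]⟩ (by simp)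
    (by simp [r₂, e₁])).mono ?_ fun _ h => h) ?_)
  · rintro i m' hi ⟨h1, hr2, hr6, hf⟩ h5
    refine RunsTo.load_seq (RunsTo.seq (τ := 1) (τ' := 1)
      (RunsTo.store (Q := fun m₃ => m₃ = (m'.setReg 7 (m.arr 1 i)).setArr 0 i (m.arr 1 i)) ?_) ?_)
    · simp [h1, hr2]
    · rintro _ rfl
      refine RunsTo.add ⟨⟨by simp [h1], by simp [hr2, h5], by simp [hr6], fun j => ?_⟩,
        by simp [h5], by simp⟩
      simp only [Mem.setReg_arr, Mem.setArr_arr, if_true, Function.update_apply, hf]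
      rcases lt_trichotomy j i with h | h | h
      · simp [h.ne, h, show j < i + 1 by omega]
      · simp [h]
      · simp [h.ne', show ¬ j < i by omega, show ¬ j < i + 1 by omega]
  · have := Nat.mul_le_mul_right (3 + 2) (vl m V hm)
    omega
  · rintro m' ⟨⟨h1, hr2, hr6, hf⟩, h4⟩
    exact RunsTo.add ⟨by simp [hr6, h4], hf⟩

/-- The program that maps a structure to its graph, started in a memory whose contents is arbitrary
apart from the input. -/
theorem Pi2Formula.exists_runsTo_graph (φ : Pi2Formula) :
    ∃ p h, PolyBounded h ∧ ∀ (A : FinStruct φ.ar) (m : Mem), m.arr 0 = cells A.encode →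
      RunsTo p m (h (m.reg 0 + A.encode.length)) fun m' =>
        IsOutput m' (encodeGraph (φ.graph (cells A.encode) A.size (m.reg 0)))
          (φ.numClasses (m.reg 0)) := by
  obtain ⟨p₁, h₁, hb₁, hp₁⟩ := exists_runsTo_fill φ.polyComp_outCell φ.polyComp_cellBound
  obtain ⟨p₂, h₂, hb₂, hp₂⟩ := exists_runsTo_copy φ.polyComp_cellBound φ.polyComp_numClasses
  refine ⟨.seq findUnary (.seq (.const 2 0) (.seq (.const 3 0) (.seq p₁ (.seq (.const 2 0) p₂)))),
    fun V => 4 * V + 5 + (1 + (1 + (h₁ (V + 2) + (1 + h₂ (V + 2))))), ?_, fun A m hA => ?_⟩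
  · exact (((PolyBounded.const 4).mul .id).add (.const 5)).add ((PolyBounded.const 1).add
      ((PolyBounded.const 1).add ((hb₁.comp (PolyBounded.id.add (.const 2))).add
        ((PolyBounded.const 1).add (hb₂.comp (PolyBounded.id.add (.const 2)))))))
  have hlen := A.length_encode
  set V := m.reg 0 + A.encode.length with hV
  refine ((runsTo_findUnary hA).mono (show 4 * A.size + 5 ≤ 4 * V + 5 by omega)
    fun _ h => h).seq ?_
  rintro m₁ ⟨a₁, hk₁, hn₁⟩
  refine RunsTo.const_seq (RunsTo.const_seq ?_)
  have hLe : ∀ m' : Mem, m'.arr 0 = m.arr 0 → m'.reg 0 = m.reg 0 → m'.reg 1 = A.size →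
      m'.reg 2 = 0 → m'.reg 3 = 0 → m'.Le (V + 2) := by
    intro m' h h0 h1 h2 h3
    refine ⟨fun i hi => ?_, fun i => ?_⟩
    · interval_cases i <;> omega
    · have := cells_le_two A.encode i
      rw [h, hA]
      omega
  refine (hp₁ _ (V + 2) (hLe _ (by simp [a₁]) (by simp [hk₁]) (by simp [hn₁]) (by simp) (by simp))
    (by simp)).seq ?_
  rintro m₂ ⟨a₂, hk₂, hn₂, hz₂, hf⟩
  simp only [Mem.setReg_arr, Mem.setReg_reg, a₁, hk₁, hn₁] at a₂ hk₂ hn₂ hz₂ hf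
  simp at hk₂ hn₂ hz₂ hf
  refine RunsTo.const_seq ((hp₂ _ (V + 2) (hLe _ (by simp [a₂]) (by simp [hk₂]) (by simp [hn₂])
    (by simp) (by simp [hz₂])) (by simp)).mono le_rfl ?_)
  rintro m₃ ⟨hk₃, hf₃⟩
  simp [hk₂, hn₂, a₂] at hk₃ hf₃
  refine ⟨funext fun i => ?_, hk₃⟩
  rw [hf₃]
  -- The copied range covers input and output: `outCell` supplies zeros that erase leftover input,
  -- and beyond the range both strings have ended.
  split_ifs with hi
  · rw [hf i hi, hA, φ.cells_encodeGraph_graph]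
  · rw [hA, cells_eq_zero.2, cells_eq_zero.2]
    · rw [length_encodeGraph]
      simp only [cellBound] at hi
      omega
    · simp only [cellBound] at hi
      omega

/-! ### Composition -/

/-- A run of `T` steps changes at most `T` cells of array `0`. -/
theorem Runs.exists_changed {p : Prog} {m m' : Mem} {T : ℕ} (h : Runs p m m' T) :
    ∃ F : Finset ℕ, F.card ≤ T ∧ ∀ i ∉ F, m'.arr 0 i = m.arr 0 i := by
  classical
  induction h with
  | const | add | sub | load => exact ⟨∅, by simp, fun _ _ => rfl⟩
  | store m a i j =>
    refine ⟨{m.reg i}, by simp, fun l hl => ?_⟩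
    rw [Finset.mem_singleton] at hl
    by_cases ha : 0 = a
    · subst ha
      simp [hl]
    · simp [ha]
  | seq hp hq ih₁ ih₂ =>
    obtain ⟨F, hF, h⟩ := ih₁
    obtain ⟨F', hF', h'⟩ := ih₂
    refine ⟨F ∪ F', (Finset.card_union_le _ _).trans (by omega), fun i hi => ?_⟩
    rw [Finset.mem_union, not_or] at hi
    rw [h' i hi.2, h i hi.1]
  | ite_true hi hp ih =>
    obtain ⟨F, hF, h⟩ := ih
    exact ⟨F, by omega, h⟩
  | ite_false hi hp ih =>
    obtain ⟨F, hF, h⟩ := ih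
    exact ⟨F, by omega, h⟩
  | while_done => exact ⟨∅, by simp, fun _ _ => rfl⟩
  | while_step hi hp hw ih₁ ih₂ =>
    obtain ⟨F, hF, h⟩ := ih₁
    obtain ⟨F', hF', h'⟩ := ih₂
    refine ⟨F ∪ F', (Finset.card_union_le _ _).trans (by omega), fun i hi => ?_⟩
    rw [Finset.mem_union, not_or] at hi
    rw [h' i hi.2, h i hi.1]

/-- Cells of a string are nonzero, so each cell of `y` beyond the end of `x` was changed during the
run. This bounds the intermediate instance of a composed reduction. -/
theorem Runs.length_le {p : Prog} {m m' : Mem} {T : ℕ} (h : Runs p m m' T) {x y : List Bool}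
    (hx : m.arr 0 = cells x) (hy : m'.arr 0 = cells y) : y.length ≤ x.length + T := by
  classical
  obtain ⟨F, hF, hc⟩ := h.exists_changed
  have hsub : Finset.range y.length ⊆ Finset.range x.length ∪ F := by
    intro i hi
    rw [Finset.mem_range] at hi
    rw [Finset.mem_union, Finset.mem_range]
    by_contra hcon
    rw [not_or, not_lt] at hcon
    have := hc i hcon.2
    rw [hx, hy, cells_eq_zero.2 hcon.1, cells_eq_zero] at this
    omega
  have := (Finset.card_le_card hsub).trans (Finset.card_union_le _ _)
  simp at this
  omega

theorem computable_pow {f : ℕ → ℕ} (hf : Computable f) (c : ℕ) : Computable fun k => f k ^ c := by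
  induction c with
  | zero => simpa using Computable.const 1
  | succ c ih =>
    simp only [pow_succ]
    exact Primrec.nat_mul.to_comp.comp ih hf

/-- A problem is hard for W[2] if the graphs of the weighted definability instances are equivalent
instances of it. -/
theorem w2Hard_of_graph {Q : ParamProblem}
    (hQ : ∀ (φ : Pi2Formula) (A : FinStruct φ.ar) (k : ℕ),
      (encodeGraph (φ.graph (cells A.encode) A.size k), φ.numClasses k) ∈ Q.inst ∧
        ((A.encode, k) ∈ (weightedDefinability φ).yes ↔
          (encodeGraph (φ.graph (cells A.encode) A.size k), φ.numClasses k) ∈ Q.yes)) :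
    W2Hard Q := by
  rintro P ⟨φ, p, f, g, c, hf, hg, hp⟩
  obtain ⟨q, h, ⟨b, hb⟩, hq⟩ := φ.exists_runsTo_graph
  have hadd : ∀ {u v : ℕ → ℕ}, Computable u → Computable v → Computable fun k => u k + v k :=
    fun hu hv => Primrec.nat_add.to_comp.comp hu hv
  -- The second program sees parameter at most `g k` and length at most `|x| + f k * X ^ c`, where
  -- `X = |x| + 1`. Their sum plus two is at most `(g k + f k + 2) * X ^ (c + 1)`, which is then
  -- raised to the exponent `b` of its time bound.
  refine ⟨.seq p q, fun k => f k + (g k + f k + 2) ^ b, fun k => (g k + 2) ^ φ.width,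
    c + (c + 1) * b, hadd hf (computable_pow (hadd (hadd hg hf) (.const 2)) b),
    computable_pow (hadd hg (.const 2)) _, fun x k hx => ?_⟩
  obtain ⟨y, l, ⟨m, T, hrun, ⟨hm, rfl⟩, hT⟩, ⟨A, rfl : y = A.encode⟩, hiff, hl⟩ := hp x k hx
  obtain ⟨m', T', hrun', hT', hout⟩ := hq A m hm
  obtain ⟨hinst, hiff'⟩ := hQ φ A (m.reg 0)
  refine ⟨_, _, ⟨m', T + T', .seq hrun hrun', hout, ?_⟩, hinst, hiff.trans hiff',
    Nat.pow_le_pow_left (by omega) _⟩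
  have hlen : A.encode.length ≤ x.length + T := hrun.length_le (by simp [inputMem]) hm
  set X := x.length + 1 with hX
  have hX1 : 1 ≤ X := by omega
  have h1 : X ^ c ≤ X ^ (c + 1) := Nat.pow_le_pow_right hX1 (by omega)
  have h2 : X ≤ X ^ (c + 1) := Nat.le_self_pow (by omega) _
  have h3 : f k * X ^ c ≤ f k * X ^ (c + 1) := Nat.mul_le_mul_left _ h1
  have h4 : 1 ≤ X ^ (c + 1) := Nat.one_le_pow _ _ hX1
  have h5 : g k * 1 ≤ g k * X ^ (c + 1) := Nat.mul_le_mul_left _ h4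
  have h6 : m.reg 0 + A.encode.length + 2 ≤ (g k + f k + 2) * X ^ (c + 1) := by
    rw [Nat.add_mul, Nat.add_mul]
    omega
  calc T + T' ≤ f k * X ^ c + ((g k + f k + 2) * X ^ (c + 1)) ^ b :=
        Nat.add_le_add hT (hT'.trans ((hb _).trans (Nat.pow_le_pow_left h6 _)))
    _ = f k * X ^ c + (g k + f k + 2) ^ b * X ^ ((c + 1) * b) := by rw [mul_pow, ← pow_mul]
    _ ≤ f k * X ^ (c + (c + 1) * b) + (g k + f k + 2) ^ b * X ^ (c + (c + 1) * b) :=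
        Nat.add_le_add (Nat.mul_le_mul_left _ (Nat.pow_le_pow_right hX1 (by omega)))
          (Nat.mul_le_mul_left _ (Nat.pow_le_pow_right hX1 (by omega)))
    _ = _ := by ring

/-! ### The reduction is correct -/

theorem weightedDefinability_yes_iff {φ : Pi2Formula} {A : FinStruct φ.ar} {k : ℕ} :
    (A.encode, k) ∈ (weightedDefinability φ).yes ↔
      ∃ f, φ.IsSelection (cells A.encode) A.size k f := by
  constructor
  · rintro ⟨A', hA' : A.encode = A'.encode, S, hS, hφ⟩
    -- Selections depend on a structure only through its size and the cells of its encoding, so the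
    -- structures themselves need not be identified.
    have hsize : A.size = A'.size := unary_injective hA'
    rw [hA', hsize]
    exact Pi2Formula.exists_isSelection_of_holds (Pi2Formula.cells_encode A') hS hφ
  · rintro ⟨f, hf⟩
    obtain ⟨S, hS⟩ := Pi2Formula.exists_finset_of_isSelection (Pi2Formula.cells_encode A) hf
    exact ⟨A, rfl, S, hS⟩

theorem graph_clawFree (φ : Pi2Formula) (inp : ℕ → ℕ) (n k : ℕ) {t : ℕ} (ht : 4 ≤ t) :
    ClawFree t (φ.graph inp n k) :=
  gadget_clawFree _ _ _ ht

end ParamComplexity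

open ParamComplexity in
theorem mainTheorem3 (t : ℕ) (ht : 4 ≤ t) :
    ParamComplexity.W2Hard (ParamComplexity.connectedDominatingSet t) ∧
      ParamComplexity.W2Hard (ParamComplexity.dominatingClique t) := by
  constructor
  all_goals
    refine w2Hard_of_graph fun φ A k =>
      ⟨⟨_, _, graph_clawFree φ _ _ _ ht, rfl⟩, weightedDefinability_yes_iff.trans ⟨?_, ?_⟩⟩
  · rintro ⟨f, hf⟩
    obtain ⟨D, hcard, hdom, hcl, hne⟩ := hf.exists_dominating A.size_pos
    exact ⟨_, _, ⟨graph_clawFree φ _ _ _ ht, rfl⟩, D, hcard, hdom, hcl.connected_induce hne⟩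
  -- Domination within the size bound already forces a selection.
  · rintro ⟨n, G, ⟨-, hG⟩, D, hcard, hdom, -⟩
    obtain ⟨rfl, rfl⟩ := encodeGraph_injective hG
    exact Pi2Formula.exists_isSelection_of_dominating A.size_pos hdom hcard
  · rintro ⟨f, hf⟩
    obtain ⟨D, hcard, hdom, hcl, -⟩ := hf.exists_dominating A.size_pos
    exact ⟨_, _, ⟨graph_clawFree φ _ _ _ ht, rfl⟩, D, hcard, hdom, hcl⟩
  · rintro ⟨n, G, ⟨-, hG⟩, D, hcard, hdom, -⟩
    obtain ⟨rfl, rfl⟩ := encodeGraph_injective hG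
    exact Pi2Formula.exists_isSelection_of_dominating A.size_pos hdom hcard
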